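/- Let $d\ge 1$ be an integer, $0<s<1$, $p>1$, $q\ge 1$, $\tau\ge 1$, $0<a\le 1$, $\alpha,\beta,\gamma\in\mathbb{R}$ and $\Lambda>1$, and define $\sigma\in\mathbb{R}$ by $\gamma=a\sigma+(1-a)\beta$. For a measurable function $u$ on $\mathbb{R}^d$ set \[ \|u\|_{\dot W^{s,p,\alpha,\Lambda}(\mathbb{R}^d)}=\left(\int_{\mathbb{R}^d}\int_{\mathbb{R}^d}\frac{|u(x)-u(y)|^p\,|x|^{\alpha p}}{|x-y|^{d+sp}}\,\chi_\Lambda(|x|,|y|)\,dx\,dy\right)^{1/p}\in[0,\infty], \] where $\chi_\Lambda(r_1,r_2)=1$ if $\Lambda^{-1}r_1\le r_2\le\Lambda r_1$ and $\chi_\Lambda(r_1,r_2)=0$ otherwise. Assume the balance law \[ \frac1\tau+\frac\gamma d=a\left(\frac1p+\frac{\alpha-s}{d}\right)+(1-a)\left(\frac1q+\frac\beta d\right), \] that $0\le\alpha-\sigma$, and that $\alpha-\sigma\le s$ if $\frac1\tau+\frac\gamma d=\frac1p+\frac{\alpha-s}{d}$. Then there exists a constant $C>0$, independent of $u$, such that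 the inequality \[ \big\||x|^\gamma u\big\|_{L^\tau(\mathbb{R}^d)}\le C\,\|u\|^{a}_{\dot W^{s,p,\alpha,\Lambda}(\mathbb{R}^d)}\,\big\||x|^\beta u\big\|^{1-a}_{L^q(\mathbb{R}^d)} \] holds in the following two cases: (i) if $\frac1\tau+\frac\gamma d>0$, for all $u\in L^1_{\mathrm{loc}}(\mathbb{R}^d\setminus\{0\})$ with compact support in $\mathbb{R}^d$; (ii) if $\frac1\tau+\frac\gamma d<0$, for all $u\in L^1_{\mathrm{loc}}(\mathbb{R}^d\setminus\{0\})$ which are $0$ in a neighborhood of $0$. Here all norms take values in $[0,\infty]$, with the conventions $\infty\cdot 0=0\cdot\infty=0$, $0^0=\infty^0=1$ (used for $a=1$) and $\infty\le\infty$. -/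

import Mathlib

open MeasureTheory Topology
open scoped NNReal ENNReal

noncomputable section

/-- The cutoff `χ_Λ(r₁, r₂)`, equal to `1` if `Λ⁻¹ r₁ ≤ r₂ ≤ Λ r₁` and to `0` otherwise. -/
def cutoff (Λ r₁ r₂ : ℝ) : ℝ :=
  if Λ⁻¹ * r₁ ≤ r₂ ∧ r₂ ≤ Λ * r₁ then 1 else 0

/-- The weighted fractional seminorm of `Ẇ^{s,p,α,Λ}(Ω)`, with values in `[0, ∞]`. -/
def fracSeminorm {d : ℕ} (s p α Λ : ℝ) (Ω : Set (EuclideanSpace ℝ (Fin d)))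
    (g : EuclideanSpace ℝ (Fin d) → ℝ) : ℝ≥0∞ :=
  (∫⁻ y in Ω, ∫⁻ x in Ω,
    ENNReal.ofReal (|g x - g y| ^ p * ‖x‖ ^ (α * p) / ‖x - y‖ ^ ((d : ℝ) + s * p)
      * cutoff Λ ‖x‖ ‖y‖)) ^ (1 / p)

/-- The weighted norm `‖ |x|^γ u ‖_{L^τ(ℝ^d)}`, with values in `[0, ∞]`. -/
def weightedNorm {d : ℕ} (γ τ : ℝ) (u : EuclideanSpace ℝ (Fin d) → ℝ) : ℝ≥0∞ :=
  eLpNorm (fun x => ‖x‖ ^ γ * u x) (ENNReal.ofReal τ) volume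

/-- `u`, as a function defined up to null sets, has compact support in `ℝ^d`. -/
def HasEssCompactSupport {d : ℕ} (u : EuclideanSpace ℝ (Fin d) → ℝ) : Prop :=
  ∃ K : Set (EuclideanSpace ℝ (Fin d)), IsCompact K ∧ ∀ᵐ x, x ∉ K → u x = 0

/-- `u`, as a function defined up to null sets, is `0` in a neighborhood of the origin. -/
def VanishesNearZero {d : ℕ} (u : EuclideanSpace ℝ (Fin d) → ℝ) : Prop :=
  ∃ U ∈ 𝓝 (0 : EuclideanSpace ℝ (Fin d)), ∀ᵐ x, x ∈ U → u x = 0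

end

/-! Cut space into shells of ratio `l = √Λ`, so that points of two adjacent shells have comparable
norms up to the factor `Λ` and are seen by the cutoff. The sign of `1 / τ + γ / d` picks a direction
`j`: outward if positive, inward if negative. Call a point `y` dominant if the mean of `v ^ τ` over
the next shell in that direction is at most `η * v y ^ τ`. At the other points `v ^ τ` is bounded by
`η⁻¹` times the mean over the next shell. Together with the weight and the volume ratio this gives a
factor below 1, so their share of the integral of `‖x‖ ^ (γ * τ) * v ^ τ` is absorbed, and the
dominant points control everything (`lintegral_shellRay_le`).

At a dominant point, `v` is smaller than `v y` by a fixed factor on a fixed proportion of the next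
shell, which bounds `v y` by the inner energy at scale `‖y‖`, a Hardy-type bound
(`le_innerEnergy_of_mem_dominantShell`). A second bound, of Sobolev type, replaces the shell by a
ball just large enough that the total integral `X` forces the mean of `v ^ τ` over it below `v y ^ τ
/ 2` (`le_innerEnergy_of_lintegral_le`). A geometric mean of the two, Hölder's inequality, and
division by the power of `X` that appears give the estimate when `0 ≤ α - σ ≤ s`
(`lintegral_shellRay_rpow_le`). The absorption needs a finite integral. This is ensured by
truncating `|u|` and by the support condition, and removed by Fatou
(`weightedNorm_le_of_vanishesAlongRay`).

If `α - σ > s`, then `1 / τ` exceeds its value for `α - σ = s`. The norm is then interpolated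
between two estimates of the case already treated, with `a` replaced by `a - e` and `a + e`, one
used near the origin and the other near infinity (`weightedNorm_le_of_lt`). -/

/-! ### Shells and rays of shells. -/

/-- The inner integral of the weighted fractional seminorm, as a function of the outer variable. -/
noncomputable def innerEnergy {d : ℕ} (s p α Λ : ℝ) (v : EuclideanSpace ℝ (Fin d) → ℝ)
    (y : EuclideanSpace ℝ (Fin d)) : ℝ≥0∞ :=
  ∫⁻ x, ENNReal.ofReal (|v x - v y| ^ p * ‖x‖ ^ (α * p) / ‖x - y‖ ^ ((d : ℝ) + s * p)
      * cutoff Λ ‖x‖ ‖y‖)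

/-- The half-open spherical shell `{l ^ k ≤ |x| < l ^ (k + 1)}`. -/
def shell {d : ℕ} (l : ℝ) (k : ℤ) : Set (EuclideanSpace ℝ (Fin d)) :=
  {x | l ^ k ≤ ‖x‖ ∧ ‖x‖ < l ^ (k + 1)}

theorem rpow_le_of_ratio_le {Λ r₁ r₂ : ℝ} (hΛ : 1 ≤ Λ) (h₁ : 0 < r₁) (h₂ : 0 < r₂)
    (h : r₁ ≤ Λ * r₂) (h' : r₂ ≤ Λ * r₁) (δ : ℝ) : r₁ ^ δ ≤ Λ ^ |δ| * r₂ ^ δ := by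
  have hΛ0 : 0 < Λ := by linarith
  rcases le_total 0 δ with hδ | hδ
  · rw [abs_of_nonneg hδ, ← Real.mul_rpow hΛ0.le h₂.le]
    exact Real.rpow_le_rpow h₁.le h hδ
  · rw [abs_of_nonpos hδ]
    have h3 : (Λ * r₁) ^ δ ≤ r₂ ^ δ := Real.rpow_le_rpow_of_nonpos h₂ h' hδ
    rw [Real.mul_rpow hΛ0.le h₁.le] at h3
    calc r₁ ^ δ = Λ ^ (-δ) * (Λ ^ δ * r₁ ^ δ) := by
          rw [← mul_assoc, ← Real.rpow_add hΛ0]; simp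
      _ ≤ _ := by gcongr

theorem cutoff_eq_one_iff {Λ r₁ r₂ : ℝ} (hΛ : 0 < Λ) :
    cutoff Λ r₁ r₂ = 1 ↔ r₁ ≤ Λ * r₂ ∧ r₂ ≤ Λ * r₁ := by
  unfold cutoff
  split_ifs with h
  · simpa [inv_mul_le_iff₀ hΛ] using h
  · simpa [inv_mul_le_iff₀ hΛ] using h

theorem measurableSet_shell {d : ℕ} (l : ℝ) (k : ℤ) :
    MeasurableSet (shell l k : Set (EuclideanSpace ℝ (Fin d))) := by
  have h : (shell l k : Set (EuclideanSpace ℝ (Fin d))) =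
      (fun x => ‖x‖) ⁻¹' Set.Ico (l ^ k) (l ^ (k + 1)) := rfl
  rw [h]
  exact measurable_norm measurableSet_Ico

theorem volume_shell {d : ℕ} {l : ℝ} (hl : 1 < l) (k : ℤ) :
    volume (shell l k : Set (EuclideanSpace ℝ (Fin d))) =
      ENNReal.ofReal ((l ^ k) ^ d * (l ^ d - 1)) *
        volume (Metric.ball (0 : EuclideanSpace ℝ (Fin d)) 1) := by
  have hl0 : 0 < l := by linarith
  have h : (shell l k : Set (EuclideanSpace ℝ (Fin d))) =
      Metric.ball 0 (l ^ (k + 1)) \ Metric.ball 0 (l ^ k) := by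
    ext x; simp [shell, and_comm]
  have hsub : l ^ k ≤ l ^ (k + 1) := zpow_le_zpow_right₀ hl.le (by lia)
  rw [h, measure_sdiff (Metric.ball_subset_ball hsub) measurableSet_ball.nullMeasurableSet
    measure_ball_lt_top.ne, Measure.addHaar_ball_of_pos _ _ (zpow_pos hl0 _),
    Measure.addHaar_ball_of_pos _ _ (zpow_pos hl0 _), finrank_euclideanSpace_fin,
    ← ENNReal.sub_mul (fun _ _ => measure_ball_lt_top.ne), ← ENNReal.ofReal_sub _ (by positivity)]
  congr 2
  rw [zpow_add_one₀ hl0.ne', mul_pow]; ring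

theorem disjoint_shell {d : ℕ} {l : ℝ} (hl : 1 < l) {k m : ℤ} (hkm : k ≠ m) :
    Disjoint (shell l k : Set (EuclideanSpace ℝ (Fin d))) (shell l m) := by
  rw [Set.disjoint_left]
  rintro x ⟨h1, h2⟩ ⟨h3, h4⟩
  have h5 := (zpow_lt_zpow_iff_right₀ hl).1 (h1.trans_lt h4)
  have h6 := (zpow_lt_zpow_iff_right₀ hl).1 (h3.trans_lt h2)
  lia

/-- The union of the shells `k₀, k₀ + j, k₀ + 2j, …`. -/
def shellRay {d : ℕ} (l : ℝ) (k₀ j : ℤ) : Set (EuclideanSpace ℝ (Fin d)) :=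
  ⋃ n : ℕ, shell l (k₀ + j * n)

theorem exists_mem_shell {d : ℕ} {l : ℝ} (hl : 1 < l) {x : EuclideanSpace ℝ (Fin d)}
    (hx : x ≠ 0) : ∃ k : ℤ, x ∈ (shell l k : Set (EuclideanSpace ℝ (Fin d))) :=
  exists_mem_Ico_zpow (norm_pos_iff.2 hx) hl

theorem norm_pos_of_mem_shell {d : ℕ} {l : ℝ} (hl : 1 < l) {k : ℤ}
    {x : EuclideanSpace ℝ (Fin d)} (hx : x ∈ shell l k) : 0 < ‖x‖ :=
  (zpow_pos (by linarith) k).trans_le hx.1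

theorem mem_shellRay_one {d : ℕ} {l : ℝ} (hl : 1 < l) {k₀ : ℤ} {x : EuclideanSpace ℝ (Fin d)} :
    x ∈ shellRay l k₀ 1 ↔ l ^ k₀ ≤ ‖x‖ := by
  simp only [shellRay, Set.mem_iUnion]
  constructor
  · rintro ⟨n, hn⟩
    exact (zpow_le_zpow_right₀ hl.le (by lia)).trans hn.1
  · intro h
    have hx : x ≠ 0 := norm_pos_iff.1 ((zpow_pos (by linarith) _).trans_le h)
    obtain ⟨k, hk⟩ := exists_mem_shell hl hx
    have h6 := (zpow_lt_zpow_iff_right₀ hl).1 (h.trans_lt hk.2)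
    refine ⟨(k - k₀).toNat, ?_⟩
    convert hk using 2
    lia

theorem mem_shellRay_neg_one {d : ℕ} {l : ℝ} (hl : 1 < l) {k₀ : ℤ}
    {x : EuclideanSpace ℝ (Fin d)} :
    x ∈ shellRay l k₀ (-1) ↔ 0 < ‖x‖ ∧ ‖x‖ < l ^ (k₀ + 1) := by
  simp only [shellRay, Set.mem_iUnion]
  constructor
  · rintro ⟨n, hn⟩
    exact ⟨norm_pos_of_mem_shell hl hn, hn.2.trans_le (zpow_le_zpow_right₀ hl.le (by lia))⟩
  · rintro ⟨h0, h⟩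
    obtain ⟨k, hk⟩ := exists_mem_shell hl (norm_pos_iff.1 h0)
    have h6 := (zpow_lt_zpow_iff_right₀ hl).1 (hk.1.trans_lt h)
    refine ⟨(k₀ - k).toNat, ?_⟩
    convert hk using 2
    lia

theorem measurableSet_shellRay {d : ℕ} (l : ℝ) (k₀ j : ℤ) :
    MeasurableSet (shellRay l k₀ j : Set (EuclideanSpace ℝ (Fin d))) :=
  MeasurableSet.iUnion fun _ => measurableSet_shell _ _

theorem lintegral_shellRay {d : ℕ} {l : ℝ} (hl : 1 < l) (k₀ : ℤ) {j : ℤ} (hj : j ≠ 0)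
    (f : EuclideanSpace ℝ (Fin d) → ℝ≥0∞) :
    ∫⁻ x in shellRay l k₀ j, f x = ∑' n : ℕ, ∫⁻ x in shell l (k₀ + j * n), f x := by
  refine lintegral_iUnion (fun _ => measurableSet_shell _ _) (fun m n hmn => ?_) f
  refine disjoint_shell hl fun h => hmn ?_
  have : j * m = j * n := by linarith
  exact_mod_cast mul_left_cancel₀ hj this

/-! ### Lower bounds for the inner energy from averages. -/

/-- A lower bound for the inner energy in terms of the values of `v` on a set where `v` is,
on average, smaller than at the base point. -/
theorem le_innerEnergy_of_average_le {d : ℕ} {s p τ η Λ : ℝ} (α : ℝ) (hp : 0 < p) (hs : 0 < s)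
    (hτ : 0 < τ) (hη0 : 0 < η) (hη1 : η < 1) (hΛ : 1 < Λ) :
    ∃ C : ℝ, 0 < C ∧ ∀ (v : EuclideanSpace ℝ (Fin d) → ℝ), Measurable v → (∀ x, 0 ≤ v x) →
      ∀ (y : EuclideanSpace ℝ (Fin d)) (B : Set (EuclideanSpace ℝ (Fin d))) (ρ : ℝ),
      y ≠ 0 → MeasurableSet B → volume B ≠ ∞ → 0 < ρ →
      (∀ x ∈ B, ‖x - y‖ ≤ ρ ∧ ‖x‖ ≤ Λ * ‖y‖ ∧ ‖y‖ ≤ Λ * ‖x‖) →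
      ∫⁻ x in B, ENNReal.ofReal (v x ^ τ) ≤ ENNReal.ofReal (η * v y ^ τ) * volume B →
      ENNReal.ofReal (v y ^ p * ‖y‖ ^ (α * p)) * volume B ≤
        ENNReal.ofReal (C * ρ ^ ((d : ℝ) + s * p)) * innerEnergy s p α Λ v y := by
  -- The loss `η` is split evenly: one factor `m` becomes the threshold `κ * v y`, the other the
  -- proportion of `B` on which that threshold may be exceeded.
  obtain ⟨m, hm0, hm1, hmη⟩ : ∃ m : ℝ, 0 < m ∧ m < 1 ∧ η = m * m :=
    ⟨√η, Real.sqrt_pos.2 hη0, by rw [Real.sqrt_lt' one_pos]; simpa using hη1,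
      (Real.mul_self_sqrt hη0.le).symm⟩
  obtain ⟨κ, hκ0, hκ1, hκm⟩ : ∃ κ : ℝ, 0 < κ ∧ κ < 1 ∧ κ ^ τ = m :=
    ⟨m ^ τ⁻¹, by positivity, Real.rpow_lt_one hm0.le hm1 (by positivity),
      Real.rpow_inv_rpow hm0.le hτ.ne'⟩
  have hΛ0 : 0 < Λ := by linarith
  have h1κ : 0 < 1 - κ := by linarith
  have h1m : 0 < 1 - m := by linarith
  refine ⟨Λ ^ |α * p| / ((1 - κ) ^ p * (1 - m)), by positivity, ?_⟩
  intro v hv hv0 y B ρ hy hB hBfin hρ hsub hint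
  have hy' : 0 < ‖y‖ := norm_pos_iff.2 hy
  rcases (hv0 y).eq_or_lt with hP | hP
  · rw [← hP, Real.zero_rpow hp.ne']; simp
  set P := v y with hPdef
  have hBs : MeasurableSet (B ∩ {x | v x ≤ κ * P}) :=
    hB.inter (measurableSet_le hv measurable_const)
  have hBl : MeasurableSet (B ∩ {x | κ * P < v x}) :=
    hB.inter (measurableSet_lt measurable_const hv)
  -- Chebyshev's inequality for `v ^ τ` at height `(κ * P) ^ τ = m * P ^ τ`.
  have hlarge : ENNReal.ofReal (m * P ^ τ) * volume (B ∩ {x | κ * P < v x}) ≤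
      ENNReal.ofReal (η * P ^ τ) * volume B := by
    refine le_trans ?_ hint
    rw [← setLIntegral_const]
    refine (setLIntegral_mono (by fun_prop) fun x hx => ?_).trans
      (lintegral_mono_set Set.inter_subset_left)
    refine ENNReal.ofReal_le_ofReal ?_
    rw [← hκm, ← Real.mul_rpow hκ0.le hP.le]
    exact Real.rpow_le_rpow (by positivity) (le_of_lt hx.2) hτ.le
  have hadd : volume.real B = volume.real (B ∩ {x | v x ≤ κ * P}) +
      volume.real (B ∩ {x | κ * P < v x}) := by
    rw [← measureReal_union _ hBl (measure_ne_top_of_subset Set.inter_subset_left hBfin)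
      (measure_ne_top_of_subset Set.inter_subset_left hBfin)]
    · congr 1
      ext x
      simp only [Set.mem_union, Set.mem_inter_iff, Set.mem_ofPred_eq]
      rcases le_or_gt (v x) (κ * P) with h | h <;> tauto
    · rw [Set.disjoint_left]
      rintro x ⟨-, h1⟩ ⟨-, h2⟩
      exact absurd (show κ * P < v x from h2) (not_lt.2 h1)
  have hlarge' : volume.real (B ∩ {x | κ * P < v x}) ≤ m * volume.real B := by
    have h := ENNReal.toReal_mono (ENNReal.mul_ne_top ENNReal.ofReal_ne_top hBfin) hlarge
    rw [ENNReal.toReal_mul, ENNReal.toReal_mul, ENNReal.toReal_ofReal (by positivity),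
      ENNReal.toReal_ofReal (by positivity), hmη] at h
    have hpos : 0 < m * P ^ τ := by positivity
    refine le_of_mul_le_mul_left ?_ hpos
    calc _ ≤ m * m * P ^ τ * volume.real B := h
      _ = _ := by ring
  have hsmall : volume B ≤ ENNReal.ofReal (1 / (1 - m)) * volume (B ∩ {x | v x ≤ κ * P}) := by
    rw [← ENNReal.ofReal_toReal hBfin, ← ENNReal.ofReal_toReal
      (measure_ne_top_of_subset (Set.inter_subset_left (t := {x | v x ≤ κ * P})) hBfin),
      ← ENNReal.ofReal_mul (by positivity)]
    refine ENNReal.ofReal_le_ofReal ?_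
    change volume.real B ≤ 1 / (1 - m) * volume.real (B ∩ {x | v x ≤ κ * P})
    rw [one_div, ← div_eq_inv_mul, le_div_iff₀ h1m]
    nlinarith
  -- Lower bound for the energy integrand on the part of `B` where `v x ≤ κ * P`.
  set K : ℝ := ((1 - κ) * P) ^ p * (‖y‖ ^ (α * p) / Λ ^ |α * p|) / ρ ^ ((d : ℝ) + s * p) with hK
  have hlow : ENNReal.ofReal K * volume (B ∩ {x | v x ≤ κ * P}) ≤ innerEnergy s p α Λ v y := by
    rw [← setLIntegral_const]
    refine le_trans ?_ (setLIntegral_le_lintegral (B ∩ {x | v x ≤ κ * P}) _)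
    refine setLIntegral_mono' hBs fun x hx => ENNReal.ofReal_le_ofReal ?_
    obtain ⟨h1, h2, h3⟩ := hsub x hx.1
    have hvx : v x ≤ κ * P := hx.2
    have hxy : 0 < ‖x - y‖ := by
      rw [norm_pos_iff, sub_ne_zero]
      rintro rfl
      nlinarith
    have hx0 : 0 < ‖x‖ := pos_of_mul_pos_right (hy'.trans_le h3) hΛ0.le
    rw [(cutoff_eq_one_iff hΛ0).2 ⟨h2, h3⟩, mul_one, hK]
    have h4 : (1 - κ) * P ≤ |v x - v y| := by
      rw [abs_sub_comm]
      exact le_trans (by linarith) (le_abs_self _)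
    have h5 : ‖y‖ ^ (α * p) / Λ ^ |α * p| ≤ ‖x‖ ^ (α * p) := by
      rw [div_le_iff₀' (by positivity)]
      exact rpow_le_of_ratio_le hΛ.le hy' hx0 h3 h2 _
    gcongr
  calc ENNReal.ofReal (P ^ p * ‖y‖ ^ (α * p)) * volume B
      ≤ ENNReal.ofReal (P ^ p * ‖y‖ ^ (α * p)) *
        (ENNReal.ofReal (1 / (1 - m)) * volume (B ∩ {x | v x ≤ κ * P})) := by gcongr
    _ = ENNReal.ofReal (Λ ^ |α * p| / ((1 - κ) ^ p * (1 - m)) * ρ ^ ((d : ℝ) + s * p)) *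
        (ENNReal.ofReal K * volume (B ∩ {x | v x ≤ κ * P})) := by
      rw [← mul_assoc, ← mul_assoc, ← ENNReal.ofReal_mul (by positivity),
        ← ENNReal.ofReal_mul (by positivity), hK, Real.mul_rpow h1κ.le hP.le]
      congr 2
      field_simp
    _ ≤ _ := by gcongr

/-! ### Dominant points and the Hardy-type absorption. -/

/-- The points of the `n`-th shell of a ray at which `η * f` dominates the mean of `f` over the
next shell. -/
def dominantShell {d : ℕ} (l η : ℝ) (k₀ j : ℤ) (f : EuclideanSpace ℝ (Fin d) → ℝ≥0∞) (n : ℕ) :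
    Set (EuclideanSpace ℝ (Fin d)) :=
  {y | y ∈ shell l (k₀ + j * n) ∧
    ∫⁻ x in shell l (k₀ + j * (n + 1 : ℕ)), f x ≤
      ENNReal.ofReal η * f y *
        volume (shell l (k₀ + j * (n + 1 : ℕ)) : Set (EuclideanSpace ℝ (Fin d)))}

theorem measurableSet_dominantShell {d : ℕ} (l η : ℝ) (k₀ j : ℤ)
    {f : EuclideanSpace ℝ (Fin d) → ℝ≥0∞} (hf : Measurable f) (n : ℕ) :
    MeasurableSet (dominantShell l η k₀ j f n) :=
  (measurableSet_shell _ _).inter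
    (measurableSet_le measurable_const ((measurable_const.mul hf).mul measurable_const))

theorem rpow_norm_le_of_mem_shell {d : ℕ} {l : ℝ} (hl : 1 < l) {k : ℤ} (δ : ℝ)
    {x : EuclideanSpace ℝ (Fin d)} (hx : x ∈ shell l k) :
    ‖x‖ ^ δ ≤ l ^ |δ| * (l ^ k) ^ δ ∧ (l ^ k) ^ δ ≤ l ^ |δ| * ‖x‖ ^ δ := by
  have hl0 : 0 < l := by linarith
  have hk : 0 < l ^ k := zpow_pos hl0 k
  have h1 : l ^ k ≤ ‖x‖ := hx.1
  have h2 : ‖x‖ ≤ l * l ^ k := by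
    rw [mul_comm, ← zpow_add_one₀ hl0.ne']; exact hx.2.le
  have h3 : l ^ k ≤ l * ‖x‖ := by nlinarith
  exact ⟨rpow_le_of_ratio_le hl.le (hk.trans_le h1) hk h2 h3 δ,
    rpow_le_of_ratio_le hl.le hk (hk.trans_le h1) h3 h2 δ⟩

/-- Off the dominant set, `f` is at most `η⁻¹` times its mean over the next shell. The power of `l`
is the ratio of the volumes of the two shells. -/
theorem lintegral_shell_le_add {d : ℕ} (hd : 1 ≤ d) {l η : ℝ} (hl : 1 < l) (hη : 0 < η)
    (k₀ j : ℤ) {f : EuclideanSpace ℝ (Fin d) → ℝ≥0∞} (hf : Measurable f) (n : ℕ) :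
    ∫⁻ x in shell l (k₀ + j * n), f x ≤ (∫⁻ x in dominantShell l η k₀ j f n, f x) +
      ENNReal.ofReal (η⁻¹ * (l ^ (-j)) ^ d) * ∫⁻ x in shell l (k₀ + j * (n + 1 : ℕ)), f x := by
  have hl0 : 0 < l := by linarith
  have hld : 0 < l ^ d - 1 := by
    have := one_lt_pow₀ hl (by lia : d ≠ 0); linarith
  set S : Set (EuclideanSpace ℝ (Fin d)) := shell l (k₀ + j * n) with hS
  set S' : Set (EuclideanSpace ℝ (Fin d)) := shell l (k₀ + j * (n + 1 : ℕ)) with hS'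
  have hb0 : volume (Metric.ball (0 : EuclideanSpace ℝ (Fin d)) 1) ≠ 0 :=
    (Metric.measure_ball_pos _ _ one_pos).ne'
  have hS'0 : volume S' ≠ 0 := by
    rw [hS', volume_shell hl]
    refine mul_ne_zero ?_ hb0
    rw [Ne, ENNReal.ofReal_eq_zero, not_le]
    have := zpow_pos hl0 (k₀ + j * (n + 1 : ℕ))
    positivity
  have hS't : volume S' ≠ ∞ := by
    rw [hS', volume_shell hl]
    exact ENNReal.mul_ne_top ENNReal.ofReal_ne_top measure_ball_lt_top.ne
  have hSS : volume S = ENNReal.ofReal ((l ^ (-j)) ^ d) * volume S' := by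
    rw [hS, hS', volume_shell hl, volume_shell hl, ← mul_assoc, ← ENNReal.ofReal_mul]
    · congr 2
      rw [← mul_assoc, ← mul_pow, ← zpow_add₀ hl0.ne']
      congr 3
      push_cast; ring
    · have := zpow_pos hl0 (-j); positivity
  have hE := measurableSet_dominantShell l η k₀ j hf n
  have hsub : dominantShell l η k₀ j f n ⊆ S := fun x hx => hx.1
  have hsplit := lintegral_inter_add_sdiff (μ := volume) f S hE
  rw [Set.inter_eq_self_of_subset_right hsub] at hsplit
  rw [← hsplit]
  gcongr
  calc ∫⁻ x in S \ dominantShell l η k₀ j f n, f x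
      ≤ ∫⁻ _ in S \ dominantShell l η k₀ j f n,
          ENNReal.ofReal η⁻¹ * ((∫⁻ x in S', f x) * (volume S')⁻¹) := by
        refine setLIntegral_mono' (MeasurableSet.diff (measurableSet_shell _ _) hE) fun y hy => ?_
        have h : ENNReal.ofReal η * f y * volume S' ≤ ∫⁻ x in S', f x := by
          by_contra hcon
          exact hy.2 ⟨hy.1, (not_le.1 hcon).le⟩
        calc f y = ENNReal.ofReal η⁻¹ * ((ENNReal.ofReal η * f y * volume S') * (volume S')⁻¹) := by
              rw [mul_assoc (_ * _), ENNReal.mul_inv_cancel hS'0 hS't, mul_one, ← mul_assoc,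
                ← ENNReal.ofReal_mul (by positivity), inv_mul_cancel₀ hη.ne']
              simp
          _ ≤ _ := by gcongr
    _ ≤ ENNReal.ofReal η⁻¹ * ((∫⁻ x in S', f x) * (volume S')⁻¹) * volume S := by
        rw [setLIntegral_const]
        gcongr
        exact Set.sdiff_subset
    _ = ENNReal.ofReal (η⁻¹ * (l ^ (-j)) ^ d) * (∫⁻ x in S', f x) *
        ((volume S')⁻¹ * volume S') := by
        rw [hSS, ENNReal.ofReal_mul (by positivity)]; ring
    _ = _ := by rw [ENNReal.inv_mul_cancel hS'0 hS't, mul_one]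

/-- A weighted Hardy-type inequality along a ray of shells. -/
theorem lintegral_shellRay_le {d : ℕ} (hd : 1 ≤ d) {l η δ : ℝ} (hl : 1 < l) (hη : 0 < η)
    {j : ℤ} (hj : j ≠ 0) (hδ : l ^ (-(j : ℝ) * (δ + d)) < η) :
    ∃ C : ℝ≥0, 0 < C ∧ ∀ (k₀ : ℤ) (f : EuclideanSpace ℝ (Fin d) → ℝ≥0∞), Measurable f →
      ∫⁻ x in shellRay l k₀ j, ENNReal.ofReal (‖x‖ ^ δ) * f x ≠ ∞ →
      ∫⁻ x in shellRay l k₀ j, ENNReal.ofReal (‖x‖ ^ δ) * f x ≤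
        C * ∫⁻ x in ⋃ n, dominantShell l η k₀ j f n, ENNReal.ofReal (‖x‖ ^ δ) * f x := by
  have hl0 : 0 < l := by linarith
  -- The contraction factor of one step along the ray: `η⁻¹` from non-dominance, `l ^ (-j * d)` from
  -- the volumes and `l ^ (-j * δ)` from the weights.
  set ρ : ℝ := η⁻¹ * l ^ (-(j : ℝ) * (δ + d)) with hρ
  have hρ1 : ρ < 1 := by rw [hρ, ← div_eq_inv_mul, div_lt_one hη]; exact hδ
  have hρ0 : 0 ≤ ρ := by positivity
  have h1ρ : 0 < 1 - ρ := by linarith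
  set A : ℝ := l ^ |δ| with hA
  have hA0 : 0 < A := by positivity
  refine ⟨Real.toNNReal (A * (1 - ρ)⁻¹ * A), by rw [Real.toNNReal_pos]; positivity, ?_⟩
  intro k₀ f hf hI
  set w : ℕ → ℝ≥0∞ := fun n => ENNReal.ofReal ((l ^ (k₀ + j * n)) ^ δ) with hw
  set X : ℝ≥0∞ := ∑' n : ℕ, w n * ∫⁻ x in shell l (k₀ + j * n), f x with hX
  set Φ : ℝ≥0∞ := ∑' n : ℕ, w n * ∫⁻ x in dominantShell l η k₀ j f n, f x with hΦ
  have hwle : ∀ (n : ℕ) (T : Set (EuclideanSpace ℝ (Fin d))), MeasurableSet T →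
      T ⊆ shell l (k₀ + j * n) →
      w n * ∫⁻ x in T, f x ≤
        ENNReal.ofReal A * ∫⁻ x in T, ENNReal.ofReal (‖x‖ ^ δ) * f x := by
    intro n T hT hsub
    rw [← lintegral_const_mul _ hf, ← lintegral_const_mul _ (by fun_prop)]
    refine setLIntegral_mono' hT fun x hx => ?_
    rw [← mul_assoc, ← ENNReal.ofReal_mul hA0.le]
    gcongr
    exact ENNReal.ofReal_le_ofReal (rpow_norm_le_of_mem_shell hl δ (hsub hx)).2
  have hIX : ∫⁻ x in shellRay l k₀ j, ENNReal.ofReal (‖x‖ ^ δ) * f x ≤ ENNReal.ofReal A * X := by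
    rw [lintegral_shellRay hl k₀ hj, hX, ← ENNReal.tsum_mul_left]
    refine ENNReal.tsum_le_tsum fun n => ?_
    rw [← mul_assoc, hw, ← ENNReal.ofReal_mul hA0.le, ← lintegral_const_mul _ hf]
    refine setLIntegral_mono' (measurableSet_shell _ _) fun x hx => ?_
    gcongr
    exact (rpow_norm_le_of_mem_shell hl δ hx).1
  have hXI : X ≤ ENNReal.ofReal A *
      ∫⁻ x in shellRay l k₀ j, ENNReal.ofReal (‖x‖ ^ δ) * f x := by
    rw [lintegral_shellRay hl k₀ hj, hX, ← ENNReal.tsum_mul_left]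
    exact ENNReal.tsum_le_tsum fun n => hwle n _ (measurableSet_shell _ _) subset_rfl
  have hXfin : X ≠ ∞ := ne_top_of_le_ne_top (ENNReal.mul_ne_top ENNReal.ofReal_ne_top hI) hXI
  have hΦI : Φ ≤ ENNReal.ofReal A *
      ∫⁻ x in ⋃ n, dominantShell l η k₀ j f n, ENNReal.ofReal (‖x‖ ^ δ) * f x := by
    rw [lintegral_iUnion (measurableSet_dominantShell l η k₀ j hf), hΦ, ← ENNReal.tsum_mul_left]
    · exact ENNReal.tsum_le_tsum fun n =>
        hwle n _ (measurableSet_dominantShell l η k₀ j hf n) fun x hx => hx.1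
    · intro m n hmn
      refine (disjoint_shell hl fun h => hmn ?_).mono (fun x hx => hx.1) fun x hx => hx.1
      have : j * m = j * n := by linarith
      exact_mod_cast mul_left_cancel₀ hj this
  have hwsucc : ∀ n, w n * ENNReal.ofReal (η⁻¹ * (l ^ (-j)) ^ d) =
      ENNReal.ofReal ρ * w (n + 1) := by
    intro n
    have h0 := zpow_pos hl0 (k₀ + j * n)
    rw [hw, ← ENNReal.ofReal_mul (by positivity), ← ENNReal.ofReal_mul hρ0]
    congr 1
    rw [hρ]
    simp only [← Real.rpow_intCast, ← Real.rpow_natCast, ← Real.rpow_mul hl0.le]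
    rw [mul_left_comm, mul_assoc, ← Real.rpow_add hl0, ← Real.rpow_add hl0]
    congr 2
    push_cast; ring
  -- Summing the one-step estimate over the ray reproduces the tail of `X` with the factor `ρ < 1`.
  -- It can be absorbed because `X` is finite.
  have hstep : X ≤ Φ + ENNReal.ofReal ρ * X := by
    calc X ≤ ∑' n : ℕ, (w n * (∫⁻ x in dominantShell l η k₀ j f n, f x) +
          ENNReal.ofReal ρ * (w (n + 1) * ∫⁻ x in shell l (k₀ + j * (n + 1 : ℕ)), f x)) := by
          refine ENNReal.tsum_le_tsum fun n => ?_
          refine (mul_le_mul_right (lintegral_shell_le_add hd hl hη k₀ j hf n) _).trans ?_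
          rw [mul_add, ← mul_assoc (w n), hwsucc, mul_assoc]
      _ = Φ + ENNReal.ofReal ρ *
          ∑' n : ℕ, w (n + 1) * ∫⁻ x in shell l (k₀ + j * (n + 1 : ℕ)), f x := by
          rw [ENNReal.tsum_add, ENNReal.tsum_mul_left]
      _ ≤ Φ + ENNReal.ofReal ρ * X := by
          gcongr
          exact ENNReal.tsum_comp_le_tsum_of_injective (add_left_injective 1)
            fun n : ℕ => w n * ∫⁻ x in shell l (k₀ + j * n), f x
  have hXΦ : X ≤ ENNReal.ofReal (1 - ρ)⁻¹ * Φ := by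
    rcases eq_or_ne Φ ∞ with hΦt | hΦt
    · rw [hΦt, ENNReal.mul_top]
      · exact le_top
      · rw [Ne, ENNReal.ofReal_eq_zero, not_le]; positivity
    · have h := ENNReal.toReal_mono (ENNReal.add_ne_top.2
        ⟨hΦt, ENNReal.mul_ne_top ENNReal.ofReal_ne_top hXfin⟩) hstep
      rw [ENNReal.toReal_add hΦt (ENNReal.mul_ne_top ENNReal.ofReal_ne_top hXfin),
        ENNReal.toReal_mul, ENNReal.toReal_ofReal hρ0] at h
      rw [← ENNReal.ofReal_toReal hXfin, ← ENNReal.ofReal_toReal hΦt,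
        ← ENNReal.ofReal_mul (by positivity)]
      refine ENNReal.ofReal_le_ofReal ?_
      rw [← div_eq_inv_mul, le_div_iff₀ h1ρ]
      linarith
  calc _ ≤ ENNReal.ofReal A * X := hIX
    _ ≤ ENNReal.ofReal A * (ENNReal.ofReal (1 - ρ)⁻¹ * (ENNReal.ofReal A * _)) := by
        gcongr
        exact hXΦ.trans (by gcongr)
    _ = _ := by
        rw [← mul_assoc, ← mul_assoc, ← ENNReal.ofReal_mul hA0.le,
          ← ENNReal.ofReal_mul (by positivity)]
        rfl

/-! ### Hardy-type and Sobolev-type bounds at dominant points. -/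

theorem ofReal_le_of_mul_le {a b c : ℝ} {g : ℝ≥0∞} (hb : 0 < b) (hc : 0 ≤ c)
    (h : ENNReal.ofReal a * ENNReal.ofReal b ≤ ENNReal.ofReal (c * b) * g) :
    ENNReal.ofReal a ≤ ENNReal.ofReal c * g := by
  rw [ENNReal.ofReal_mul hc, mul_right_comm] at h
  exact (ENNReal.mul_le_mul_iff_left (by simpa using hb) ENNReal.ofReal_ne_top).1 h

theorem norm_le_mul_zpow_of_mem_shell {d : ℕ} {l : ℝ} (hl : 1 < l) {j k : ℤ}
    (hj : j = 1 ∨ j = -1) {y : EuclideanSpace ℝ (Fin d)} (hy : y ∈ shell l k) :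
    ‖y‖ ≤ l * l * l ^ (k + j) := by
  have hl0 : 0 < l := by linarith
  have h : l * l * l ^ (k + j) = l ^ (k + j + 2) := by
    rw [zpow_add₀ hl0.ne' (k + j) 2, mul_comm]; norm_cast; rw [sq]
  rw [h]
  exact hy.2.le.trans (zpow_le_zpow_right₀ hl.le (by lia))

/-- Two adjacent shells together span radii within a factor `l * l`. This is why the shells are
taken of ratio `√Λ`. -/
theorem norm_ratio_of_mem_shell {d : ℕ} {l : ℝ} (hl : 1 < l) {j k : ℤ}
    (hj : j = 1 ∨ j = -1) {x y : EuclideanSpace ℝ (Fin d)} (hx : x ∈ shell l (k + j))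
    (hy : y ∈ shell l k) : ‖x‖ ≤ l * l * ‖y‖ ∧ ‖y‖ ≤ l * l * ‖x‖ := by
  have hl0 : 0 < l := by linarith
  constructor
  · have h := norm_le_mul_zpow_of_mem_shell (j := -j) hl (by lia) hx
    rw [add_neg_cancel_right] at h
    exact h.trans (by gcongr; exact hy.1)
  · exact (norm_le_mul_zpow_of_mem_shell hl hj hy).trans (by gcongr; exact hx.1)

/-- Dominance is exactly the average condition of `le_innerEnergy_of_average_le` on the whole next
shell, whose volume is at least a multiple of `‖y‖ ^ d` and whose points lie within `(Λ + 1) * ‖y‖`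
of `y`. -/
theorem le_innerEnergy_of_mem_dominantShell {d : ℕ} (hd : 1 ≤ d) {s p τ η l Λ : ℝ} (α : ℝ)
    (hp : 0 < p) (hs : 0 < s) (hτ : 0 < τ) (hη0 : 0 < η) (hη1 : η < 1) (hl : 1 < l)
    (hlΛ : l * l = Λ) {j : ℤ} (hj : j = 1 ∨ j = -1) :
    ∃ C : ℝ, 0 < C ∧ ∀ (v : EuclideanSpace ℝ (Fin d) → ℝ), Measurable v → (∀ x, 0 ≤ v x) →
      ∀ (k₀ : ℤ) (n : ℕ), ∀ y ∈ dominantShell l η k₀ j (fun x => ENNReal.ofReal (v x ^ τ)) n,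
      ENNReal.ofReal (v y ^ p * ‖y‖ ^ (α * p)) ≤
        ENNReal.ofReal (C * ‖y‖ ^ (s * p)) * innerEnergy s p α Λ v y := by
  have hl0 : 0 < l := by linarith
  have hΛ : 1 < Λ := by nlinarith
  have hΛ0 : 0 < Λ := by linarith
  have hld : 0 < l ^ d - 1 := by
    have := one_lt_pow₀ hl (by lia : d ≠ 0); linarith
  obtain ⟨C, hC, H⟩ := le_innerEnergy_of_average_le (d := d) α hp hs hτ hη0 hη1 hΛ
  set ω : ℝ := volume.real (Metric.ball (0 : EuclideanSpace ℝ (Fin d)) 1) with hω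
  have hω0 : 0 < ω :=
    ENNReal.toReal_pos (Metric.measure_ball_pos _ _ one_pos).ne' measure_ball_lt_top.ne
  set c : ℝ := (l ^ d - 1) * ω / Λ ^ d with hc
  have hc0 : 0 < c := by positivity
  refine ⟨C * (Λ + 1) ^ ((d : ℝ) + s * p) / c, by positivity, ?_⟩
  intro v hv hv0 k₀ n y hy
  have hy0 : 0 < ‖y‖ := norm_pos_of_mem_shell hl hy.1
  have hcast : k₀ + j * ((n + 1 : ℕ) : ℤ) = k₀ + j * n + j := by push_cast; ring
  have hdom := hy.2
  rw [hcast] at hdom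
  have hvol := volume_shell (d := d) hl (k₀ + j * n + j)
  have hfin : volume (shell l (k₀ + j * n + j) : Set (EuclideanSpace ℝ (Fin d))) ≠ ∞ := by
    rw [hvol]; exact ENNReal.mul_ne_top ENNReal.ofReal_ne_top measure_ball_lt_top.ne
  have h := H v hv hv0 y (shell l (k₀ + j * n + j)) ((Λ + 1) * ‖y‖) (norm_pos_iff.1 hy0)
    (measurableSet_shell _ _) hfin (by positivity) (fun x hx => by
      obtain ⟨h1, h2⟩ := norm_ratio_of_mem_shell hl hj hx hy.1
      rw [hlΛ] at h1 h2
      refine ⟨?_, h1, h2⟩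
      linarith [norm_sub_le x y]) (by rwa [ENNReal.ofReal_mul hη0.le])
  have hlow : ENNReal.ofReal (c * ‖y‖ ^ d) ≤
      volume (shell l (k₀ + j * n + j) : Set (EuclideanSpace ℝ (Fin d))) := by
    have h3 := norm_le_mul_zpow_of_mem_shell hl hj hy.1
    rw [hvol, ← ENNReal.ofReal_toReal (measure_ball_lt_top (μ := volume)
      (x := (0 : EuclideanSpace ℝ (Fin d))) (r := 1)).ne, ← ENNReal.ofReal_mul
      (by have := zpow_pos hl0 (k₀ + j * n + j); positivity)]
    refine ENNReal.ofReal_le_ofReal ?_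
    change _ ≤ _ * ω
    calc c * ‖y‖ ^ d ≤ c * (l * l * l ^ (k₀ + j * n + j)) ^ d := by gcongr
      _ = _ := by rw [hc, hlΛ, mul_pow]; field_simp
  have hv0y := hv0 y
  refine ofReal_le_of_mul_le (b := c * ‖y‖ ^ d) (by positivity) (by positivity) ?_
  refine (mul_le_mul_right hlow _).trans (h.trans_eq ?_)
  congr 2
  rw [Real.mul_rpow (by positivity) hy0.le, Real.rpow_add hy0, Real.rpow_natCast]
  field_simp

/-- A ball centred at `y` could leave the ray, where nothing is known about the integral of `v ^ τ`.
Moving the centre radially by `ρ` in the direction `j` keeps the ball inside, and the smallness of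
`ρ` keeps its points comparable to `y`. -/
theorem ball_shift_subset {d : ℕ} {l Λ ρ : ℝ} (hl : 1 < l) (hΛ : 1 < Λ) {k₀ j : ℤ}
    (hj : j = 1 ∨ j = -1) {y : EuclideanSpace ℝ (Fin d)} (hy : y ∈ shellRay l k₀ j)
    (hρ : 0 < ρ) (hρy : 2 * ρ ≤ (1 - Λ⁻¹) * ‖y‖) :
    ∃ z : EuclideanSpace ℝ (Fin d), Metric.ball z ρ ⊆ shellRay l k₀ j ∧
      ∀ x ∈ Metric.ball z ρ, ‖x - y‖ ≤ 2 * ρ ∧ ‖x‖ ≤ Λ * ‖y‖ ∧ ‖y‖ ≤ Λ * ‖x‖ := by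
  have hΛ0 : 0 < Λ := by linarith
  have hΛi : Λ⁻¹ < 1 := inv_lt_one_of_one_lt₀ hΛ
  have hΛi0 : 0 < Λ⁻¹ := by positivity
  have hΛΛ : Λ * Λ⁻¹ = 1 := mul_inv_cancel₀ hΛ0.ne'
  have hy0 : 0 < ‖y‖ := by
    obtain ⟨n, hn⟩ := Set.mem_iUnion.1 hy
    exact norm_pos_of_mem_shell hl hn
  have hclose : ∀ x : EuclideanSpace ℝ (Fin d), ‖x - y‖ ≤ 2 * ρ →
      ‖x‖ ≤ Λ * ‖y‖ ∧ ‖y‖ ≤ Λ * ‖x‖ := by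
    intro x hx
    have h1 : ‖x‖ - ‖y‖ ≤ ‖x - y‖ := norm_sub_norm_le x y
    have h2 : ‖y‖ - ‖x‖ ≤ ‖x - y‖ := by rw [norm_sub_rev]; exact norm_sub_norm_le y x
    constructor
    · nlinarith [mul_pos (sub_pos.2 hΛ) (sub_pos.2 hΛi)]
    · have h3 : Λ⁻¹ * ‖y‖ ≤ ‖x‖ := by linarith
      rwa [inv_mul_le_iff₀ hΛ0] at h3
  have hρ1 : ρ / ‖y‖ < 1 := by rw [div_lt_one hy0]; nlinarith
  have hρ0 : 0 < ρ / ‖y‖ := by positivity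
  have hρm : ρ / ‖y‖ * ‖y‖ = ρ := div_mul_cancel₀ _ hy0.ne'
  have hmain : ∀ e : ℝ, |e| = 1 → ∀ x ∈ Metric.ball ((1 + e * (ρ / ‖y‖)) • y) ρ,
      ‖x - y‖ ≤ 2 * ρ := by
    intro e he x hx
    rw [mem_ball_iff_norm] at hx
    have h : x - y = (x - (1 + e * (ρ / ‖y‖)) • y) + (e * (ρ / ‖y‖)) • y := by module
    have h4 : ‖(e * (ρ / ‖y‖)) • y‖ = ρ := by
      rw [norm_smul, Real.norm_eq_abs, abs_mul, he, one_mul, abs_of_pos hρ0, hρm]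
    rw [h]
    linarith [norm_add_le (x - (1 + e * (ρ / ‖y‖)) • y) ((e * (ρ / ‖y‖)) • y)]
  rcases hj with rfl | rfl
  · refine ⟨(1 + 1 * (ρ / ‖y‖)) • y, fun x hx => ?_, fun x hx =>
      ⟨hmain 1 (by simp) x hx, hclose x (hmain 1 (by simp) x hx)⟩⟩
    rw [mem_shellRay_one hl] at hy ⊢
    rw [mem_ball_iff_norm'] at hx
    have h5 : ‖(1 + 1 * (ρ / ‖y‖)) • y‖ = ‖y‖ + ρ := by
      rw [norm_smul, Real.norm_eq_abs, abs_of_pos (by linarith)]; linarith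
    linarith [norm_sub_norm_le ((1 + 1 * (ρ / ‖y‖)) • y) x]
  · refine ⟨(1 + -1 * (ρ / ‖y‖)) • y, fun x hx => ?_, fun x hx =>
      ⟨hmain (-1) (by simp) x hx, hclose x (hmain (-1) (by simp) x hx)⟩⟩
    rw [mem_shellRay_neg_one hl] at hy ⊢
    have h6 := (hclose x (hmain (-1) (by simp) x hx)).2
    rw [mem_ball_iff_norm] at hx
    have h5 : ‖(1 + -1 * (ρ / ‖y‖)) • y‖ = ‖y‖ - ρ := by
      rw [norm_smul, Real.norm_eq_abs, abs_of_pos (by linarith)]; linarith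
    refine ⟨pos_of_mul_pos_right (hy0.trans_le h6) hΛ0.le, ?_⟩
    linarith [norm_sub_norm_le x ((1 + -1 * (ρ / ‖y‖)) • y)]

/-- The mean of `v ^ τ` over a ball of radius `ρ` at distance about `‖y‖` from the origin is at most
a multiple of `‖y‖ ^ (-δ) * X / ρ ^ d`. Choosing `ρ` so that this equals half of `v y ^ τ` puts the
energy at scale `ρ` rather than `‖y‖`. -/
theorem le_innerEnergy_of_lintegral_le {d : ℕ} (hd : 1 ≤ d) {s p τ η l Λ : ℝ} (α δ : ℝ)
    (hp : 0 < p) (hs : 0 < s) (hτ : 0 < τ) (hη0 : 0 < η) (hη1 : η < 1) (hl : 1 < l)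
    (hlΛ : l * l = Λ) {j : ℤ} (hj : j = 1 ∨ j = -1) :
    ∃ C : ℝ, 0 < C ∧ ∀ (v : EuclideanSpace ℝ (Fin d) → ℝ), Measurable v → (∀ x, 0 ≤ v x) →
      ∀ (k₀ : ℤ) (n : ℕ), ∀ y ∈ dominantShell l η k₀ j (fun x => ENNReal.ofReal (v x ^ τ)) n,
      0 < v y → ∀ X : ℝ, 0 < X →
      ∫⁻ x in shellRay l k₀ j, ENNReal.ofReal (‖x‖ ^ δ) * ENNReal.ofReal (v x ^ τ) ≤
        ENNReal.ofReal X →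
      ENNReal.ofReal (v y ^ p * ‖y‖ ^ (α * p)) ≤
        ENNReal.ofReal (C * (‖y‖ ^ (-δ) * X / v y ^ τ) ^ (s * p / d)) *
          innerEnergy s p α Λ v y := by
  have hl0 : 0 < l := by linarith
  have hΛ : 1 < Λ := by nlinarith
  have hΛ0 : 0 < Λ := by linarith
  have hd0 : (0 : ℝ) < d := by exact_mod_cast hd
  obtain ⟨C₁, hC₁, H₁⟩ :=
    le_innerEnergy_of_mem_dominantShell hd α hp hs hτ hη0 hη1 hl hlΛ hj
  obtain ⟨C₂, hC₂, H₂⟩ := le_innerEnergy_of_average_le (d := d) (η := 1 / 2) α hp hs hτ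
    (by norm_num) (by norm_num) hΛ
  set ω : ℝ := volume.real (Metric.ball (0 : EuclideanSpace ℝ (Fin d)) 1) with hω
  have hω0 : 0 < ω :=
    ENNReal.toReal_pos (Metric.measure_ball_pos _ _ one_pos).ne' measure_ball_lt_top.ne
  have hΛi : 0 < 1 - Λ⁻¹ := sub_pos.2 (inv_lt_one_of_one_lt₀ hΛ)
  set c : ℝ := 1 - Λ⁻¹ with hc
  set D₁ : ℝ := C₁ * (2 / c) ^ (s * p) with hD₁
  set D₂ : ℝ := C₂ * 2 ^ ((d : ℝ) + s * p) / ω with hD₂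
  -- Chosen so that the mean over the ball of volume `ω * b * T` comes out as exactly `1 / 2 * P ^
  -- τ`.
  set b : ℝ := 2 * Λ ^ |δ| / ω with hb
  have hb0 : 0 < b := by positivity
  refine ⟨(D₁ + D₂) * b ^ (s * p / d), by positivity, ?_⟩
  intro v hv hv0 k₀ n y hy hvy X hX hint
  have hy0 : 0 < ‖y‖ := norm_pos_of_mem_shell hl hy.1
  set r : ℝ := ‖y‖ with hr
  set P : ℝ := v y with hP
  set T : ℝ := r ^ (-δ) * X / P ^ τ with hT
  have hT0 : 0 < T := by positivity
  set ρ : ℝ := (b * T) ^ (1 / (d : ℝ)) with hρ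
  have hρ0 : 0 < ρ := by positivity
  have hρd : ρ ^ d = b * T := by
    rw [hρ, ← Real.rpow_natCast, ← Real.rpow_mul (by positivity), one_div,
      inv_mul_cancel₀ hd0.ne', Real.rpow_one]
  have hρsp : ρ ^ (s * p) = b ^ (s * p / d) * T ^ (s * p / d) := by
    rw [hρ, ← Real.rpow_mul (by positivity), Real.mul_rpow hb0.le hT0.le, one_div_mul_eq_div]
  suffices h : ENNReal.ofReal (P ^ p * r ^ (α * p)) ≤
      ENNReal.ofReal ((D₁ + D₂) * ρ ^ (s * p)) * innerEnergy s p α Λ v y by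
    rwa [hρsp, ← mul_assoc] at h
  -- If the ball is too large to be comparable to `y`, then `r` is at most a multiple of `ρ` and the
  -- Hardy-type bound is already stronger. Only this case uses that `y` is dominant.
  rcases le_or_gt (2 * ρ) (c * r) with hcase | hcase
  · obtain ⟨z, hz1, hz2⟩ := ball_shift_subset hl hΛ hj
      (Set.mem_iUnion.2 ⟨n, hy.1⟩ : y ∈ shellRay l k₀ j) hρ0 hcase
    have hvol : volume (Metric.ball z ρ) = ENNReal.ofReal (ω * ρ ^ d) := by
      rw [Measure.addHaar_ball_of_pos _ _ hρ0, finrank_euclideanSpace_fin,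
        ← ENNReal.ofReal_toReal (measure_ball_lt_top (μ := volume)
        (x := (0 : EuclideanSpace ℝ (Fin d))) (r := 1)).ne, ← ENNReal.ofReal_mul (by positivity),
        mul_comm]
      rfl
    have hballint : ∫⁻ x in Metric.ball z ρ, ENNReal.ofReal (v x ^ τ) ≤
        ENNReal.ofReal (1 / 2 * P ^ τ) * volume (Metric.ball z ρ) := by
      calc ∫⁻ x in Metric.ball z ρ, ENNReal.ofReal (v x ^ τ)
          ≤ ∫⁻ x in Metric.ball z ρ, ENNReal.ofReal (Λ ^ |δ| * r ^ (-δ)) *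
            (ENNReal.ofReal (‖x‖ ^ δ) * ENNReal.ofReal (v x ^ τ)) := by
            refine setLIntegral_mono' measurableSet_ball fun x hx => ?_
            obtain ⟨-, h2, h3⟩ := hz2 x hx
            have hx0 : 0 < ‖x‖ := pos_of_mul_pos_right (hy0.trans_le h3) hΛ0.le
            rw [← mul_assoc, ← ENNReal.ofReal_mul (by positivity)]
            refine le_mul_of_one_le_left' ?_
            rw [ENNReal.one_le_ofReal]
            have h4 := rpow_le_of_ratio_le hΛ.le hy0 hx0 h3 h2 δ
            calc 1 = r ^ (-δ) * r ^ δ := by rw [← Real.rpow_add hy0]; simp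
              _ ≤ r ^ (-δ) * (Λ ^ |δ| * ‖x‖ ^ δ) := by gcongr
              _ = _ := by ring
        _ = ENNReal.ofReal (Λ ^ |δ| * r ^ (-δ)) * ∫⁻ x in Metric.ball z ρ,
            ENNReal.ofReal (‖x‖ ^ δ) * ENNReal.ofReal (v x ^ τ) :=
            lintegral_const_mul _ (by fun_prop)
        _ ≤ ENNReal.ofReal (Λ ^ |δ| * r ^ (-δ)) * ENNReal.ofReal X := by
            gcongr
            exact (lintegral_mono_set hz1).trans hint
        _ = _ := by
            rw [hvol, ← ENNReal.ofReal_mul (by positivity), ← ENNReal.ofReal_mul (by positivity),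
              hρd, hb, hT]
            congr 1
            field_simp
    have h := H₂ v hv hv0 y (Metric.ball z ρ) (2 * ρ) (norm_pos_iff.1 hy0) measurableSet_ball
      measure_ball_lt_top.ne (by positivity) hz2 hballint
    rw [hvol] at h
    have h' : ENNReal.ofReal (P ^ p * r ^ (α * p)) ≤
        ENNReal.ofReal (D₂ * ρ ^ (s * p)) * innerEnergy s p α Λ v y := by
      refine ofReal_le_of_mul_le (b := ω * ρ ^ d) (by positivity)
        (by positivity) (h.trans_eq ?_)
      congr 2
      rw [Real.mul_rpow two_pos.le hρ0.le, Real.rpow_add hρ0, Real.rpow_natCast, hD₂]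
      field_simp
    refine h'.trans ?_
    gcongr
    exact le_add_of_nonneg_left (by positivity)
  · refine (H₁ v hv hv0 k₀ n y hy).trans ?_
    gcongr ENNReal.ofReal ?_ * _
    have hrρ : r ≤ 2 / c * ρ := by rw [div_mul_eq_mul_div, le_div_iff₀ hΛi]; linarith
    calc C₁ * r ^ (s * p) ≤ C₁ * (2 / c * ρ) ^ (s * p) := by gcongr
      _ = D₁ * ρ ^ (s * p) := by rw [Real.mul_rpow (by positivity) hρ0.le, hD₁]; ring
      _ ≤ _ := by
        gcongr
        exact le_add_of_nonneg_right (by positivity)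

/-! ### The estimate along one ray. -/

theorem measurable_cutoff (Λ : ℝ) : Measurable fun z : ℝ × ℝ => cutoff Λ z.1 z.2 := by
  unfold cutoff
  refine Measurable.ite ?_ measurable_const measurable_const
  exact (measurableSet_le (measurable_fst.const_mul Λ⁻¹) measurable_snd).inter
    (measurableSet_le measurable_snd (measurable_fst.const_mul Λ))

theorem measurable_innerEnergy {d : ℕ} (s p α Λ : ℝ) {v : EuclideanSpace ℝ (Fin d) → ℝ}
    (hv : Measurable v) : Measurable (innerEnergy s p α Λ v) := by
  unfold innerEnergy
  refine Measurable.lintegral_prod_right' (f := fun z : _ × _ => ENNReal.ofReal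
    (|v z.2 - v z.1| ^ p * ‖z.2‖ ^ (α * p) / ‖z.2 - z.1‖ ^ ((d : ℝ) + s * p)
      * cutoff Λ ‖z.2‖ ‖z.1‖)) ?_
  have h : Measurable fun z : EuclideanSpace ℝ (Fin d) × EuclideanSpace ℝ (Fin d) =>
      cutoff Λ ‖z.2‖ ‖z.1‖ :=
    (measurable_cutoff Λ).comp (measurable_snd.norm.prodMk measurable_fst.norm)
  fun_prop

/-- Geometric interpolation of two bounds on `P`, with exponents dictated by scaling. -/
theorem rpow_mul_rpow_le_of_two_bounds {P r G X C₁ C₂ s p q τ a t α β γ d Z A₁ A₂ B : ℝ}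
    (hP : 0 < P) (hr : 0 < r) (hG : 0 < G) (hX : 0 < X) (hC₁ : 0 < C₁) (hC₂ : 0 < C₂)
    (hA₁ : 0 ≤ A₁) (hA₂ : 0 ≤ A₂)
    (hk : A₂ * (s * p / d) = 1 - Z) (hA₁s : A₁ * (s * p) = a * (s - t) * Z * τ)
    (hA : (A₁ + A₂) * p = a * Z * τ) (hB : B * q = (1 - a) * Z * τ)
    (hγ : γ = a * (α - s + t) + (1 - a) * β)
    (h₁ : P ^ p * r ^ (α * p) ≤ C₁ * r ^ (s * p) * G)
    (h₂ : P ^ p * r ^ (α * p) ≤ C₂ * (r ^ (-(γ * τ)) * X / P ^ τ) ^ (s * p / d) * G) :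
    r ^ (γ * τ) * P ^ τ ≤
      C₁ ^ A₁ * C₂ ^ A₂ * X ^ (1 - Z) * (G ^ (A₁ + A₂) * (r ^ (β * q) * P ^ q) ^ B) := by
  have e₁ := Real.log_le_log (by positivity) h₁
  have e₂ := Real.log_le_log (by positivity) h₂
  rw [← Real.log_le_log_iff (by positivity) (by positivity)]
  rw [Real.log_mul (by positivity) (by positivity), Real.log_mul (by positivity) (by positivity),
    Real.log_mul (by positivity) (by positivity)] at e₁ e₂
  rw [Real.log_mul (by positivity) (by positivity), Real.log_mul (by positivity) (by positivity),
    Real.log_mul (by positivity) (by positivity), Real.log_mul (by positivity) (by positivity),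
    Real.log_mul (by positivity) (by positivity)]
  rw [Real.log_rpow (by positivity : 0 < r ^ (-(γ * τ)) * X / P ^ τ),
    Real.log_div (by positivity) (by positivity), Real.log_mul (by positivity) hX.ne'] at e₂
  rw [Real.log_rpow (by positivity : 0 < r ^ (β * q) * P ^ q),
    Real.log_mul (by positivity) (by positivity)]
  simp only [Real.log_rpow hP, Real.log_rpow hr, Real.log_rpow hG, Real.log_rpow hX,
    Real.log_rpow hC₁, Real.log_rpow hC₂] at e₁ e₂ ⊢
  -- After taking logarithms the claim is linear: `A₁` times the first bound plus `A₂` times the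
  -- second, with the scaling relations matching all coefficients.
  have f₁ := mul_le_mul_of_nonneg_left e₁ hA₁
  have f₂ := mul_le_mul_of_nonneg_left e₂ hA₂
  generalize Real.log P = LP at *
  generalize Real.log r = LR at *
  generalize Real.log X = LX at *
  generalize Real.log G = LG at *
  generalize Real.log C₁ = L₁ at *
  generalize Real.log C₂ = L₂ at *
  have f₂' : A₂ * (p * LP + α * p * LR) ≤
      A₂ * L₂ + (1 - Z) * (-(γ * τ) * LR + LX - τ * LP) + A₂ * LG := by
    rw [← hk]; linarith
  have hγ' : Z * τ * γ = Z * τ * (a * (α - s + t) + (1 - a) * β) := by rw [← hγ]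
  linear_combination f₁ + f₂' + LR * hA₁s - (LP + α * LR) * hA - (β * LR + LP) * hB + LR * hγ'

/-- The parameter `t` stands for `s - (α - σ)`. The pointwise bounds at dominant points are mixed
with weights proportional to `1 - t / s` and `t / s`, so `t = 0` is the pure Hardy case and `t = s`
the pure Sobolev case. -/
theorem lintegral_shellRay_rpow_le {d : ℕ} (hd : 1 ≤ d) {s p q τ a t α β γ Λ l : ℝ}
    (hs : 0 < s) (hp : 0 < p) (hq : 0 < q) (hτ : 0 < τ) (ha0 : 0 < a) (ha1 : a ≤ 1)
    (ht0 : 0 ≤ t) (hts : t ≤ s) (hl : 1 < l) (hlΛ : l * l = Λ)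
    (hτeq : 1 / τ = a / p + (1 - a) / q - a * t / d)
    (hγ : γ = a * (α - s + t) + (1 - a) * β) {j : ℤ} (hj : j = 1 ∨ j = -1)
    (hsign : 0 < j * (γ * τ + d)) :
    ∃ C : ℝ≥0, 0 < C ∧ ∀ (v : EuclideanSpace ℝ (Fin d) → ℝ), Measurable v → (∀ x, 0 ≤ v x) →
      ∀ k₀ : ℤ,
      ∫⁻ x in shellRay l k₀ j, ENNReal.ofReal (‖x‖ ^ (γ * τ)) * ENNReal.ofReal (v x ^ τ) ≠ ∞ →
      (∫⁻ x in shellRay l k₀ j,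
          ENNReal.ofReal (‖x‖ ^ (γ * τ)) * ENNReal.ofReal (v x ^ τ)) ^ (1 / τ) ≤
        C * (∫⁻ y, innerEnergy s p α Λ v y) ^ (a / p) *
          (∫⁻ x, ENNReal.ofReal (‖x‖ ^ (β * q) * v x ^ q)) ^ ((1 - a) / q) := by
  have hd0 : (0 : ℝ) < d := by exact_mod_cast hd
  have hl0 : 0 < l := by linarith
  have h1a : 0 ≤ 1 - a := by linarith
  -- The sign condition makes the power of `l` smaller than 1. This leaves room for an `η` below 1,
  -- as the energy bounds need, and above that power, as the absorption needs.
  obtain ⟨η, hη, hη1⟩ : ∃ η, l ^ (-(j : ℝ) * (γ * τ + d)) < η ∧ η < 1 :=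
    exists_between (Real.rpow_lt_one_of_one_lt_of_neg hl (by linarith))
  have hη0 : 0 < η := lt_trans (by positivity) hη
  obtain ⟨C₀, hC₀, H₀⟩ := lintegral_shellRay_le hd hl hη0 (by lia : j ≠ 0) hη
  obtain ⟨C₁, hC₁, H₁⟩ := le_innerEnergy_of_mem_dominantShell hd α hp hs hτ hη0 hη1 hl hlΛ hj
  obtain ⟨C₂, hC₂, H₂⟩ :=
    le_innerEnergy_of_lintegral_le hd α (γ * τ) hp hs hτ hη0 hη1 hl hlΛ hj
  have hden : 0 < d + a * t * τ := by positivity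
  -- `Z` is fixed by `A₁ + A₂ + B = 1`, the condition for Hölder's inequality. The power of `X` from
  -- the Sobolev-type bound is then `1 - Z`.
  set Z : ℝ := d / (d + a * t * τ) with hZ
  have hZ0 : 0 < Z := by positivity
  set A₁ : ℝ := a * (1 - t / s) * Z * τ / p with hA₁
  set A₂ : ℝ := a * (t / s) * Z * τ / p with hA₂
  set B : ℝ := (1 - a) * Z * τ / q with hB
  have hA₁0 : 0 ≤ A₁ := by
    have : 0 ≤ 1 - t / s := sub_nonneg.2 ((div_le_one hs).2 hts)
    positivity
  have hA₂0 : 0 ≤ A₂ := by positivity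
  have hB0 : 0 ≤ B := by positivity
  have hAeq : A₁ + A₂ = a * Z * τ / p := by rw [hA₁, hA₂]; ring
  have hA0 : 0 < A₁ + A₂ := by rw [hAeq]; positivity
  have hk : A₂ * (s * p / d) = 1 - Z := by
    rw [hA₂, hZ]; field_simp; ring
  have hsum : A₁ + A₂ + B = 1 := by
    have h : A₁ + A₂ + B = Z * τ * (1 / τ + a * t / d) := by
      rw [hAeq, hB, hτeq]; ring
    rw [h, hZ]; field_simp
  have hC₀' : (0 : ℝ) < C₀ := hC₀
  set K : ℝ := C₀ * (C₁ ^ A₁ * C₂ ^ A₂) with hK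
  have hK0 : 0 < K := by positivity
  refine ⟨(Real.toNNReal K) ^ (1 / (Z * τ)), NNReal.rpow_pos (by simpa using hK0), ?_⟩
  intro v hv hv0 k₀ hfin
  set I : ℝ≥0∞ := ∫⁻ x in shellRay l k₀ j,
    ENNReal.ofReal (‖x‖ ^ (γ * τ)) * ENNReal.ofReal (v x ^ τ) with hI
  rcases eq_or_ne I 0 with hI0 | hI0
  · rw [hI0, ENNReal.zero_rpow_of_pos (by positivity)]; exact zero_le
  set X : ℝ := I.toReal with hX
  have hX0 : 0 < X := ENNReal.toReal_pos hI0 hfin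
  have hIX : I = ENNReal.ofReal X := (ENNReal.ofReal_toReal hfin).symm
  set g : EuclideanSpace ℝ (Fin d) → ℝ≥0∞ := innerEnergy s p α Λ v with hg
  set h : EuclideanSpace ℝ (Fin d) → ℝ≥0∞ :=
    fun x => ENNReal.ofReal (‖x‖ ^ (β * q) * v x ^ q) with hh
  have hgm : Measurable g := measurable_innerEnergy s p α Λ hv
  have hhm : Measurable h := by fun_prop
  set f : EuclideanSpace ℝ (Fin d) → ℝ≥0∞ := fun x => ENNReal.ofReal (v x ^ τ) with hf
  have hfm : Measurable f := by fun_prop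
  have hEm : MeasurableSet (⋃ n, dominantShell l η k₀ j f n) :=
    MeasurableSet.iUnion (measurableSet_dominantShell l η k₀ j hfm)
  have hpt : ∀ y ∈ ⋃ n, dominantShell l η k₀ j f n,
      ENNReal.ofReal (‖y‖ ^ (γ * τ)) * f y ≤
        ENNReal.ofReal (C₁ ^ A₁ * C₂ ^ A₂ * X ^ (1 - Z)) * (g y ^ (A₁ + A₂) * h y ^ B) := by
    intro y hy
    obtain ⟨n, hn⟩ := Set.mem_iUnion.1 hy
    have hy0 : 0 < ‖y‖ := norm_pos_of_mem_shell hl hn.1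
    rcases (hv0 y).eq_or_lt with hvy | hvy
    · simp [hf, ← hvy, Real.zero_rpow hτ.ne']
    have e₁ := H₁ v hv hv0 k₀ n y hn
    have e₂ := H₂ v hv hv0 k₀ n y hn hvy X hX0 hIX.le
    have hypos : 0 < ‖y‖ ^ (β * q) * v y ^ q := by positivity
    rcases eq_or_ne (g y) ∞ with hgy | hgy
    · rw [hgy, ENNReal.top_rpow_of_pos hA0, ENNReal.top_mul, ENNReal.mul_top]
      · exact le_top
      · rw [Ne, ENNReal.ofReal_eq_zero, not_le]; positivity
      · simp only [hh]
        rw [ENNReal.ofReal_rpow_of_pos hypos, Ne, ENNReal.ofReal_eq_zero, not_le]; positivity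
    have hgG : g y = ENNReal.ofReal (g y).toReal := (ENNReal.ofReal_toReal hgy).symm
    set G : ℝ := (g y).toReal with hG
    have hG0 : 0 ≤ G := ENNReal.toReal_nonneg
    change _ ≤ _ * g y at e₁
    change _ ≤ _ * g y at e₂
    rw [hgG, ← ENNReal.ofReal_mul (by positivity),
      ENNReal.ofReal_le_ofReal_iff (by positivity)] at e₁ e₂
    have hGpos : 0 < G := by
      rcases hG0.eq_or_lt with h0 | h0
      · rw [← h0, mul_zero] at e₁
        exact absurd e₁ (not_le.2 (by positivity))
      · exact h0
    simp only [hf, hh]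
    rw [hgG, ENNReal.ofReal_rpow_of_pos hGpos, ENNReal.ofReal_rpow_of_pos hypos,
      ← ENNReal.ofReal_mul (by positivity), ← ENNReal.ofReal_mul (by positivity),
      ← ENNReal.ofReal_mul (by positivity)]
    refine ENNReal.ofReal_le_ofReal ?_
    refine rpow_mul_rpow_le_of_two_bounds (a := a) (t := t) hvy hy0 hGpos hX0 hC₁ hC₂ hA₁0 hA₂0
      hk ?_ ?_ ?_ hγ e₁ e₂
    · rw [hA₁]; field_simp
    · rw [hAeq]; field_simp
    · rw [hB]; field_simp
  have hbound : I ≤ C₀ * (ENNReal.ofReal (C₁ ^ A₁ * C₂ ^ A₂ * X ^ (1 - Z)) *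
      ((∫⁻ y, g y) ^ (A₁ + A₂) * (∫⁻ y, h y) ^ B)) := by
    refine (H₀ k₀ f hfm hfin).trans ?_
    gcongr
    refine (setLIntegral_mono' hEm hpt).trans ?_
    refine (setLIntegral_le_lintegral _ _).trans ?_
    rw [lintegral_const_mul _ (by fun_prop)]
    gcongr
    exact ENNReal.lintegral_mul_norm_pow_le hgm.aemeasurable hhm.aemeasurable hA0.le hB0 hsum
  -- Division by `X ^ (1 - Z)`, legitimate since `X` is positive and finite.
  have hIZ : I ^ Z ≤ ENNReal.ofReal K * ((∫⁻ y, g y) ^ (A₁ + A₂) * (∫⁻ y, h y) ^ B) := by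
    rw [hIX, ENNReal.ofReal_rpow_of_pos hX0]
    refine ofReal_le_of_mul_le (b := X ^ (1 - Z)) (by positivity) hK0.le ?_
    rw [← ENNReal.ofReal_mul (by positivity), ← Real.rpow_add hX0, add_sub_cancel,
      Real.rpow_one, ← hIX]
    refine hbound.trans_eq ?_
    rw [← mul_assoc, ← ENNReal.ofReal_coe_nnreal, ← ENNReal.ofReal_mul hC₀'.le, hK]
    congr 2
    ring
  have hZτ : 0 < 1 / (Z * τ) := by positivity
  calc I ^ (1 / τ) = (I ^ Z) ^ (1 / (Z * τ)) := by
        rw [← ENNReal.rpow_mul]; congr 1; field_simp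
    _ ≤ (ENNReal.ofReal K * ((∫⁻ y, g y) ^ (A₁ + A₂) * (∫⁻ y, h y) ^ B)) ^ (1 / (Z * τ)) := by
        gcongr
    _ = _ := by
        rw [ENNReal.mul_rpow_of_nonneg _ _ hZτ.le, ENNReal.mul_rpow_of_nonneg _ _ hZτ.le,
          ← ENNReal.rpow_mul, ← ENNReal.rpow_mul, ← mul_assoc,
          ENNReal.coe_rpow_of_nonneg _ hZτ.le, hAeq, hB]
        have h₁ : a * Z * τ / p * (1 / (Z * τ)) = a / p := by field_simp
        have h₂ : (1 - a) * Z * τ / q * (1 / (Z * τ)) = (1 - a) / q := by field_simp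
        rw [h₁, h₂]
        rfl

/-! ### From one ray to the whole space. -/

theorem fracSeminorm_univ_eq {d : ℕ} (s p α Λ : ℝ) (u : EuclideanSpace ℝ (Fin d) → ℝ) :
    fracSeminorm s p α Λ Set.univ u = (∫⁻ y, innerEnergy s p α Λ u y) ^ (1 / p) := by
  simp only [fracSeminorm, innerEnergy, Measure.restrict_univ]

theorem fracSeminorm_univ_congr_ae {d : ℕ} (s p α Λ : ℝ) {u v : EuclideanSpace ℝ (Fin d) → ℝ}
    (h : u =ᵐ[volume] v) :
    fracSeminorm s p α Λ Set.univ u = fracSeminorm s p α Λ Set.univ v := by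
  rw [fracSeminorm_univ_eq, fracSeminorm_univ_eq]
  congr 1
  refine lintegral_congr_ae ?_
  filter_upwards [h] with y hy
  refine lintegral_congr_ae ?_
  filter_upwards [h] with x hx
  rw [hx, hy]

theorem weightedNorm_congr_ae {d : ℕ} (γ τ : ℝ) {u v : EuclideanSpace ℝ (Fin d) → ℝ}
    (h : u =ᵐ[volume] v) : weightedNorm γ τ u = weightedNorm γ τ v := by
  refine eLpNorm_congr_ae ?_
  filter_upwards [h] with x hx
  rw [hx]

theorem innerEnergy_mono {d : ℕ} {s p α Λ : ℝ} (hp : 0 ≤ p) {u v : EuclideanSpace ℝ (Fin d) → ℝ}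
    (h : ∀ x y, |v x - v y| ≤ |u x - u y|) (y : EuclideanSpace ℝ (Fin d)) :
    innerEnergy s p α Λ v y ≤ innerEnergy s p α Λ u y := by
  refine lintegral_mono fun x => ENNReal.ofReal_le_ofReal ?_
  have hc : 0 ≤ cutoff Λ ‖x‖ ‖y‖ := by unfold cutoff; split_ifs <;> norm_num
  have := h x y
  gcongr

theorem weightedNorm_eq {d : ℕ} (γ : ℝ) {τ : ℝ} (hτ : 0 < τ) (u : EuclideanSpace ℝ (Fin d) → ℝ) :
    weightedNorm γ τ u = (∫⁻ x, ENNReal.ofReal (‖x‖ ^ (γ * τ) * |u x| ^ τ)) ^ (1 / τ) := by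
  rw [weightedNorm, eLpNorm_eq_lintegral_rpow_enorm_toReal (by simpa using hτ)
    ENNReal.ofReal_ne_top, ENNReal.toReal_ofReal hτ.le]
  congr 1
  refine lintegral_congr fun x => ?_
  rw [Real.enorm_eq_ofReal_abs, ENNReal.ofReal_rpow_of_nonneg (abs_nonneg _) hτ.le, abs_mul,
    Real.mul_rpow (abs_nonneg _) (abs_nonneg _), abs_of_nonneg (by positivity),
    ← Real.rpow_mul (norm_nonneg _)]

/-- Only finitely many shells contribute, and on each the weight and `v` are bounded. This supplies
the finiteness that the absorption requires. -/
theorem lintegral_shellRay_ne_top {d : ℕ} {l δ τ M : ℝ} (hl : 1 < l) (hτ : 0 < τ) {k₀ j : ℤ}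
    (hj : j ≠ 0) {v : EuclideanSpace ℝ (Fin d) → ℝ} (hv0 : ∀ x, 0 ≤ v x) (hvM : ∀ x, v x ≤ M)
    (hsupp : ∀ᶠ n : ℕ in Filter.atTop, ∀ᵐ x : EuclideanSpace ℝ (Fin d),
      x ∈ shell l (k₀ + j * n) → v x = 0) :
    ∫⁻ x in shellRay l k₀ j, ENNReal.ofReal (‖x‖ ^ δ) * ENNReal.ofReal (v x ^ τ) ≠ ∞ := by
  have hl0 : 0 < l := by linarith
  rw [lintegral_shellRay hl k₀ hj]
  obtain ⟨N, hN⟩ := Filter.eventually_atTop.1 hsupp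
  rw [tsum_eq_sum (s := Finset.range N)]
  · refine (ENNReal.sum_lt_top.2 fun n _ => ?_).ne
    calc _ ≤ ∫⁻ _ in (shell l (k₀ + j * n) : Set (EuclideanSpace ℝ (Fin d))),
          ENNReal.ofReal (l ^ |δ| * (l ^ (k₀ + j * n)) ^ δ) * ENNReal.ofReal (M ^ τ) := by
          refine setLIntegral_mono' (measurableSet_shell _ _) fun x hx => ?_
          gcongr
          · exact (rpow_norm_le_of_mem_shell hl δ hx).1
          · exact hv0 x
          · exact hvM x
      _ < ∞ := by
          rw [setLIntegral_const, volume_shell hl]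
          exact ENNReal.mul_lt_top
            (ENNReal.mul_lt_top ENNReal.ofReal_lt_top ENNReal.ofReal_lt_top)
            (ENNReal.mul_lt_top ENNReal.ofReal_lt_top measure_ball_lt_top)
  · intro n hn
    rw [setLIntegral_congr_fun_ae (g := fun _ => 0) (measurableSet_shell _ _), lintegral_zero]
    filter_upwards [hN n (by simpa using hn)] with x hx hxs
    rw [hx hxs, Real.zero_rpow hτ.ne']
    simp

/-- `u` vanishes almost everywhere on all but finitely many shells of each ray in direction `j`. -/
def VanishesAlongRay {d : ℕ} (l : ℝ) (j : ℤ) (u : EuclideanSpace ℝ (Fin d) → ℝ) : Prop :=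
  ∀ k₀ : ℤ, ∀ᶠ n : ℕ in Filter.atTop, ∀ᵐ x : EuclideanSpace ℝ (Fin d),
    x ∈ shell l (k₀ + j * n) → u x = 0

theorem HasEssCompactSupport.vanishesAlongRay {d : ℕ} {l : ℝ} (hl : 1 < l)
    {u : EuclideanSpace ℝ (Fin d) → ℝ} (hu : HasEssCompactSupport u) :
    VanishesAlongRay l 1 u := by
  intro k₀
  have hl0 : 0 < l := by linarith
  obtain ⟨K, hK, huK⟩ := hu
  obtain ⟨R, hR⟩ := hK.isBounded.exists_norm_le
  obtain ⟨N, hN⟩ := pow_unbounded_of_one_lt (R / l ^ k₀) hl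
  filter_upwards [Filter.eventually_ge_atTop N] with n hn
  filter_upwards [huK] with x hx hxs
  refine hx fun hxK => ?_
  have h1 := hR x hxK
  have h2 : l ^ (k₀ + 1 * (n : ℤ)) ≤ ‖x‖ := hxs.1
  rw [one_mul, zpow_add₀ hl0.ne', zpow_natCast] at h2
  rw [div_lt_iff₀ (zpow_pos hl0 _)] at hN
  have h3 : l ^ N ≤ l ^ n := pow_le_pow_right₀ hl.le hn
  have h4 := mul_le_mul_of_nonneg_left h3 (zpow_pos hl0 k₀).le
  linarith

theorem VanishesNearZero.vanishesAlongRay {d : ℕ} {l : ℝ} (hl : 1 < l)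
    {u : EuclideanSpace ℝ (Fin d) → ℝ} (hu : VanishesNearZero u) :
    VanishesAlongRay l (-1) u := by
  intro k₀
  have hl0 : 0 < l := by linarith
  obtain ⟨U, hU, huU⟩ := hu
  obtain ⟨ε, hε, hεU⟩ := Metric.mem_nhds_iff.1 hU
  obtain ⟨N, hN⟩ := pow_unbounded_of_one_lt (l ^ (k₀ + 1) / ε) hl
  filter_upwards [Filter.eventually_ge_atTop N] with n hn
  filter_upwards [huU] with x hx hxs
  refine hx (hεU ?_)
  rw [mem_ball_zero_iff]
  refine lt_of_lt_of_le hxs.2 ?_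
  rw [show k₀ + -1 * (n : ℤ) + 1 = k₀ + 1 - n by ring, zpow_sub₀ hl0.ne', zpow_natCast]
  rw [div_lt_iff₀ hε] at hN
  rw [div_le_iff₀ (by positivity), mul_comm]
  exact hN.le.trans (by gcongr; exact hl.le)

theorem eventually_mem_shellRay {d : ℕ} {l : ℝ} (hl : 1 < l) {j : ℤ} (hj : j = 1 ∨ j = -1)
    {x : EuclideanSpace ℝ (Fin d)} (hx : x ≠ 0) :
    ∀ᶠ n : ℕ in Filter.atTop, x ∈ shellRay l (-j * n) j := by
  obtain ⟨k, hk⟩ := exists_mem_shell hl hx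
  filter_upwards [Filter.eventually_ge_atTop k.natAbs] with n hn
  refine Set.mem_iUnion.2 ⟨(n + j * k).toNat, ?_⟩
  convert hk using 2
  rcases hj with rfl | rfl <;> lia

theorem EuclideanSpace.ae_ne_zero {d : ℕ} (hd : 1 ≤ d) :
    ∀ᵐ x : EuclideanSpace ℝ (Fin d), x ≠ 0 := by
  have : Nonempty (Fin d) := ⟨⟨0, hd⟩⟩
  exact Measure.ae_ne volume 0

/-- The ray estimate has a constant independent of the starting shell and of `v`. It is applied to
truncations of `|u|` on rays starting ever further back, and Fatou's lemma passes to the limit. -/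
theorem weightedNorm_le_of_vanishesAlongRay {d : ℕ} (hd : 1 ≤ d) {s p q τ a t α β γ Λ l : ℝ}
    (hs : 0 < s) (hp : 0 < p) (hq : 0 < q) (hτ : 0 < τ) (ha0 : 0 < a) (ha1 : a ≤ 1)
    (ht0 : 0 ≤ t) (hts : t ≤ s) (hl : 1 < l) (hlΛ : l * l = Λ)
    (hτeq : 1 / τ = a / p + (1 - a) / q - a * t / d)
    (hγ : γ = a * (α - s + t) + (1 - a) * β) {j : ℤ} (hj : j = 1 ∨ j = -1)
    (hsign : 0 < j * (γ * τ + d)) :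
    ∃ C : ℝ≥0, 0 < C ∧ ∀ u : EuclideanSpace ℝ (Fin d) → ℝ, AEMeasurable u volume →
      VanishesAlongRay l j u →
      weightedNorm γ τ u ≤
        C * fracSeminorm s p α Λ Set.univ u ^ a * weightedNorm β q u ^ (1 - a) := by
  obtain ⟨C, hC, H⟩ := lintegral_shellRay_rpow_le hd hs hp hq hτ ha0 ha1 ht0 hts hl hlΛ hτeq hγ
    hj hsign
  refine ⟨C, hC, ?_⟩
  suffices hmeas : ∀ u : EuclideanSpace ℝ (Fin d) → ℝ, Measurable u → VanishesAlongRay l j u →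
      weightedNorm γ τ u ≤
        C * fracSeminorm s p α Λ Set.univ u ^ a * weightedNorm β q u ^ (1 - a) by
    intro u hu hsupp
    rw [weightedNorm_congr_ae γ τ hu.ae_eq_mk, weightedNorm_congr_ae β q hu.ae_eq_mk,
      fracSeminorm_univ_congr_ae s p α Λ hu.ae_eq_mk]
    refine hmeas _ hu.measurable_mk fun k₀ => ?_
    filter_upwards [hsupp k₀] with n hn
    filter_upwards [hn, hu.ae_eq_mk] with x hx hxu hxs
    rw [← hxu, hx hxs]
  intro u hu hsupp
  have h1a : 0 ≤ 1 - a := by linarith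
  set R : ℝ≥0∞ :=
    C * fracSeminorm s p α Λ Set.univ u ^ a * weightedNorm β q u ^ (1 - a) with hR
  -- Taking absolute values and truncating are contractions, so neither norm on the right increases.
  set v : ℕ → EuclideanSpace ℝ (Fin d) → ℝ := fun n x => min |u x| n with hv
  have hvm : ∀ n, Measurable (v n) := fun n => by
    have : Measurable fun x => |u x| := hu.norm
    exact this.min measurable_const
  have hv0 : ∀ n x, 0 ≤ v n x := fun n x => le_min (abs_nonneg _) (Nat.cast_nonneg n)
  have hvu : ∀ n x, v n x ≤ |u x| := fun n x => min_le_left _ _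
  have hvsub : ∀ n x y, |v n x - v n y| ≤ |u x - u y| := fun n x y => by
    refine (abs_min_sub_min_le_max _ _ _ _).trans ?_
    simpa using abs_abs_sub_abs_le (u x) (u y)
  have hbound : ∀ n : ℕ, ∫⁻ x in shellRay l (-j * n) j,
      ENNReal.ofReal (‖x‖ ^ (γ * τ)) * ENNReal.ofReal (v n x ^ τ) ≤ R ^ τ := by
    intro n
    have hfin := lintegral_shellRay_ne_top (δ := γ * τ) (k₀ := -j * n) hl hτ (by lia : j ≠ 0)
      (hv0 n) (fun x => min_le_right _ _) (by
        filter_upwards [hsupp (-j * n)] with m hm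
        filter_upwards [hm] with x hx hxs
        simp [hv, hx hxs])
    have h := H (v n) (hvm n) (hv0 n) (-j * n) hfin
    have hRle : C * (∫⁻ y, innerEnergy s p α Λ (v n) y) ^ (a / p) *
        (∫⁻ x, ENNReal.ofReal (‖x‖ ^ (β * q) * v n x ^ q)) ^ ((1 - a) / q) ≤ R := by
      rw [hR, fracSeminorm_univ_eq, weightedNorm_eq β hq, ← ENNReal.rpow_mul, ← ENNReal.rpow_mul,
        one_div_mul_eq_div, one_div_mul_eq_div]
      gcongr with y x
      · exact innerEnergy_mono hp.le (hvsub n) y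
      · exact hvu n x
    calc _ = ((∫⁻ x in shellRay l (-j * n) j,
          ENNReal.ofReal (‖x‖ ^ (γ * τ)) * ENNReal.ofReal (v n x ^ τ)) ^ (1 / τ)) ^ τ := by
          rw [← ENNReal.rpow_mul, one_div_mul_cancel hτ.ne', ENNReal.rpow_one]
      _ ≤ R ^ τ := by
          gcongr
          exact h.trans hRle
  set f : ℕ → EuclideanSpace ℝ (Fin d) → ℝ≥0∞ := fun n => (shellRay l (-j * n) j).indicator
    fun x => ENNReal.ofReal (‖x‖ ^ (γ * τ)) * ENNReal.ofReal (v n x ^ τ) with hf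
  have hfm : ∀ n, Measurable (f n) := fun n => by
    have := hvm n
    exact Measurable.indicator (by fun_prop) (measurableSet_shellRay _ _ _)
  have hlim : ∀ᵐ x : EuclideanSpace ℝ (Fin d), ENNReal.ofReal (‖x‖ ^ (γ * τ) * |u x| ^ τ) ≤
      Filter.liminf (fun n => f n x) Filter.atTop := by
    filter_upwards [EuclideanSpace.ae_ne_zero hd] with x hx
    refine le_of_eq (Filter.Tendsto.liminf_eq ?_).symm
    refine tendsto_const_nhds.congr' ?_
    obtain ⟨N, hN⟩ := exists_nat_ge |u x|
    filter_upwards [eventually_mem_shellRay hl hj hx, Filter.eventually_ge_atTop N] with n hn hnN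
    have hle : |u x| ≤ n := hN.trans (by exact_mod_cast hnN)
    simp only [hf, Set.indicator_of_mem hn, hv]
    rw [min_eq_left hle, ENNReal.ofReal_mul (by positivity)]
  have hfatou : ∫⁻ x, ENNReal.ofReal (‖x‖ ^ (γ * τ) * |u x| ^ τ) ≤ R ^ τ := by
    refine (lintegral_mono_ae hlim).trans ((lintegral_liminf_le hfm).trans ?_)
    refine (Filter.liminf_le_liminf (v := fun _ => R ^ τ)
      (Filter.Eventually.of_forall fun n => ?_)).trans_eq (Filter.liminf_const _)
    rw [hf, lintegral_indicator (measurableSet_shellRay _ _ _)]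
    exact hbound n
  rw [weightedNorm_eq γ hτ]
  calc _ ≤ (R ^ τ) ^ (1 / τ) := by gcongr
    _ = R := by rw [← ENNReal.rpow_mul, mul_one_div_cancel hτ.ne', ENNReal.rpow_one]

/-! ### Interpolation for `α - σ > s`. -/

theorem lintegral_norm_rpow_eq {d : ℕ} (hd : 1 ≤ d) {e : ℝ} {T : Set ℝ} (hT : MeasurableSet T)
    (hT0 : T ⊆ Set.Ioi 0) (hint : IntegrableOn (fun y : ℝ => y ^ ((d : ℝ) - 1 + e)) T) :
    ∫⁻ x in (fun x : EuclideanSpace ℝ (Fin d) => ‖x‖) ⁻¹' T, ENNReal.ofReal (‖x‖ ^ e) =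
      ENNReal.ofReal (d * volume.real (Metric.ball (0 : EuclideanSpace ℝ (Fin d)) 1) *
        ∫ y in T, y ^ ((d : ℝ) - 1 + e)) := by
  have : Nonempty (Fin d) := ⟨⟨0, hd⟩⟩
  set f : ℝ → ℝ := T.indicator fun y => y ^ e with hf
  have hfx : ∀ x : EuclideanSpace ℝ (Fin d), ((fun x : EuclideanSpace ℝ (Fin d) => ‖x‖) ⁻¹'
      T).indicator (fun x => ENNReal.ofReal (‖x‖ ^ e)) x = ENNReal.ofReal (f ‖x‖) := by
    intro x
    by_cases hx : ‖x‖ ∈ T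
    · rw [hf, Set.indicator_of_mem hx, Set.indicator_of_mem (by exact hx)]
    · rw [hf, Set.indicator_of_notMem hx, Set.indicator_of_notMem (by exact hx),
        ENNReal.ofReal_zero]
  have hfy : Set.EqOn (fun y => y ^ (Module.finrank ℝ (EuclideanSpace ℝ (Fin d)) - 1) • f y)
      (T.indicator fun y => y ^ ((d : ℝ) - 1 + e)) (Set.Ioi 0) := by
    intro y hy
    have hy0 : 0 < y := hy
    by_cases hyT : y ∈ T
    · simp only [hf, Set.indicator_of_mem hyT, finrank_euclideanSpace_fin, smul_eq_mul]
      rw [Real.rpow_add hy0, ← Real.rpow_natCast, Nat.cast_sub hd, Nat.cast_one]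
    · simp [hf, Set.indicator_of_notMem hyT]
  have hf0 : ∀ y, 0 ≤ y → 0 ≤ f y := fun y hy =>
    Set.indicator_apply_nonneg fun _ => Real.rpow_nonneg hy e
  have hfint : Integrable (fun x : EuclideanSpace ℝ (Fin d) => f ‖x‖) := by
    rw [integrable_fun_norm_addHaar, integrableOn_congr_fun hfy measurableSet_Ioi]
    exact ((integrable_indicator_iff hT).2 hint).integrableOn
  rw [← lintegral_indicator (measurable_norm hT), lintegral_congr hfx,
    ← ofReal_integral_eq_lintegral_ofReal hfint
      (Filter.Eventually.of_forall fun x => hf0 _ (norm_nonneg x)),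
    integral_fun_norm_addHaar, setIntegral_congr_fun measurableSet_Ioi hfy,
    setIntegral_indicator hT, Set.inter_eq_self_of_subset_right hT0, finrank_euclideanSpace_fin,
    nsmul_eq_mul, smul_eq_mul, mul_assoc]

theorem lintegral_norm_rpow_Ioc_le {d : ℕ} (hd : 1 ≤ d) {e : ℝ} (he : 0 < e + d) :
    ∃ K : ℝ, 0 < K ∧ ∀ R : ℝ, 0 < R →
      ∫⁻ x in (fun x : EuclideanSpace ℝ (Fin d) => ‖x‖) ⁻¹' Set.Ioc 0 R,
        ENNReal.ofReal (‖x‖ ^ e) ≤ ENNReal.ofReal (K * R ^ (e + d)) := by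
  have hd0 : (0 : ℝ) < d := by exact_mod_cast hd
  have hω0 : 0 < volume.real (Metric.ball (0 : EuclideanSpace ℝ (Fin d)) 1) :=
    ENNReal.toReal_pos (Metric.measure_ball_pos _ _ one_pos).ne' measure_ball_lt_top.ne
  refine ⟨d * volume.real (Metric.ball (0 : EuclideanSpace ℝ (Fin d)) 1) / (e + d),
    by positivity, fun R hR => ?_⟩
  have hexp : -1 < (d : ℝ) - 1 + e := by linarith
  rw [lintegral_norm_rpow_eq hd measurableSet_Ioc (fun y hy => hy.1)
    ((intervalIntegrable_iff_integrableOn_Ioc_of_le hR.le).1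
      (intervalIntegral.intervalIntegrable_rpow' hexp)),
    ← intervalIntegral.integral_of_le hR.le, integral_rpow (Or.inl hexp)]
  refine (congrArg ENNReal.ofReal ?_).le
  have h1 : (d : ℝ) - 1 + e + 1 = e + d := by ring
  rw [h1, Real.zero_rpow he.ne']
  ring

theorem lintegral_norm_rpow_Ioi_le {d : ℕ} (hd : 1 ≤ d) {e : ℝ} (he : e + d < 0) :
    ∃ K : ℝ, 0 < K ∧ ∀ R : ℝ, 0 < R →
      ∫⁻ x in (fun x : EuclideanSpace ℝ (Fin d) => ‖x‖) ⁻¹' Set.Ioi R,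
        ENNReal.ofReal (‖x‖ ^ e) ≤ ENNReal.ofReal (K * R ^ (e + d)) := by
  have hd0 : (0 : ℝ) < d := by exact_mod_cast hd
  have hω0 : 0 < volume.real (Metric.ball (0 : EuclideanSpace ℝ (Fin d)) 1) :=
    ENNReal.toReal_pos (Metric.measure_ball_pos _ _ one_pos).ne' measure_ball_lt_top.ne
  have he' : 0 < -(e + d) := by linarith
  refine ⟨d * volume.real (Metric.ball (0 : EuclideanSpace ℝ (Fin d)) 1) / (-(e + d)),
    by positivity, fun R hR => ?_⟩
  have hexp : (d : ℝ) - 1 + e < -1 := by linarith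
  rw [lintegral_norm_rpow_eq hd measurableSet_Ioi (fun y hy => hR.trans hy)
    (integrableOn_Ioi_rpow_of_lt hexp hR), integral_Ioi_rpow_of_lt hexp hR]
  refine (congrArg ENNReal.ofReal ?_).le
  have h1 : (d : ℝ) - 1 + e + 1 = e + d := by ring
  rw [h1, div_neg, neg_div]
  ring

/-- Hölder's inequality between weighted norms on a set whose radial weight integral is
controlled by a power of `R`. -/
theorem setLIntegral_le_weightedNorm_rpow {d : ℕ} (hd : 1 ≤ d) {γ τ γ₁ τ₁ e r K R : ℝ}
    (hτ : 0 < τ) (hττ₁ : τ < τ₁) (hr : 1 / r = 1 / τ - 1 / τ₁) (he : e = (γ - γ₁) * r)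
    (hK : 0 < K) (hR : 0 < R) {S : Set (EuclideanSpace ℝ (Fin d))}
    (hS : ∫⁻ x in S, ENNReal.ofReal (‖x‖ ^ e) ≤ ENNReal.ofReal (K * R ^ (e + d)))
    {u : EuclideanSpace ℝ (Fin d) → ℝ} (hu : AEMeasurable u volume) :
    ∫⁻ x in S, ENNReal.ofReal (‖x‖ ^ (γ * τ) * |u x| ^ τ) ≤
      (ENNReal.ofReal (K ^ (1 / r) * R ^ (d * (1 / τ + γ / d - (1 / τ₁ + γ₁ / d)))) *
        weightedNorm γ₁ τ₁ u) ^ τ := by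
  have hd0 : (0 : ℝ) < d := by exact_mod_cast hd
  have hτ₁ : 0 < τ₁ := hτ.trans hττ₁
  have hr0 : 0 < r := by
    rw [← one_div_pos, hr, sub_pos]
    exact one_div_lt_one_div_of_lt hτ hττ₁
  have hsum : τ / r + τ / τ₁ = 1 := by
    rw [div_eq_mul_one_div, hr]; field_simp; ring
  have hum : AEMeasurable (fun x => |u x|) volume := hu.norm
  have hexp : (e + d) * (1 / r) = d * (1 / τ + γ / d - (1 / τ₁ + γ₁ / d)) := by
    rw [he]
    have : d * (1 / τ + γ / d - (1 / τ₁ + γ₁ / d)) = d * (1 / τ - 1 / τ₁) + (γ - γ₁) := by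
      field_simp; ring
    rw [this, ← hr]; field_simp; ring
  calc ∫⁻ x in S, ENNReal.ofReal (‖x‖ ^ (γ * τ) * |u x| ^ τ)
      ≤ ∫⁻ x in S, ENNReal.ofReal (‖x‖ ^ e) ^ (τ / r) *
          ENNReal.ofReal (‖x‖ ^ (γ₁ * τ₁) * |u x| ^ τ₁) ^ (τ / τ₁) := by
        refine lintegral_mono_ae ?_
        filter_upwards [ae_restrict_of_ae (EuclideanSpace.ae_ne_zero hd)] with x hx
        have hx0 : 0 < ‖x‖ := norm_pos_iff.2 hx
        rw [ENNReal.ofReal_rpow_of_nonneg (by positivity) (by positivity),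
          ENNReal.ofReal_rpow_of_nonneg (by positivity) (by positivity),
          ← ENNReal.ofReal_mul (by positivity)]
        refine (congrArg ENNReal.ofReal ?_).le
        rw [Real.mul_rpow (by positivity) (by positivity), ← Real.rpow_mul hx0.le,
          ← Real.rpow_mul hx0.le, ← Real.rpow_mul (abs_nonneg _), ← mul_assoc,
          ← Real.rpow_add hx0, he]
        congr 2 <;> field_simp
        ring
    _ ≤ (∫⁻ x in S, ENNReal.ofReal (‖x‖ ^ e)) ^ (τ / r) *
        (∫⁻ x in S, ENNReal.ofReal (‖x‖ ^ (γ₁ * τ₁) * |u x| ^ τ₁)) ^ (τ / τ₁) := by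
        refine ENNReal.lintegral_mul_norm_pow_le (by fun_prop) ?_ (by positivity) (by positivity)
          hsum
        have := hum.restrict (s := S)
        fun_prop
    _ ≤ ENNReal.ofReal (K * R ^ (e + d)) ^ (τ / r) *
        (∫⁻ x, ENNReal.ofReal (‖x‖ ^ (γ₁ * τ₁) * |u x| ^ τ₁)) ^ (τ / τ₁) := by
        gcongr
        exact Measure.restrict_le_self
    _ = _ := by
        rw [weightedNorm_eq γ₁ hτ₁, ENNReal.mul_rpow_of_nonneg _ _ hτ.le, ← ENNReal.rpow_mul,
          one_div_mul_eq_div, ENNReal.ofReal_rpow_of_pos (by positivity),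
          ENNReal.ofReal_rpow_of_pos (by positivity), ← hexp, Real.rpow_mul hR.le,
          ← Real.mul_rpow hK.le (by positivity), ← Real.rpow_mul (by positivity),
          one_div_mul_eq_div]

theorem ae_eq_zero_of_weightedNorm_eq_zero {d : ℕ} (hd : 1 ≤ d) {γ τ : ℝ} (hτ : 0 < τ)
    {u : EuclideanSpace ℝ (Fin d) → ℝ} (hu : AEMeasurable u volume)
    (h : weightedNorm γ τ u = 0) : u =ᵐ[volume] 0 := by
  have hm : AEMeasurable (fun x => ‖x‖ ^ γ * u x) volume := by fun_prop
  rw [weightedNorm, eLpNorm_eq_zero_iff hm.aestronglyMeasurable (by simpa using hτ)] at h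
  filter_upwards [h, EuclideanSpace.ae_ne_zero hd] with x hx hx0
  exact (mul_eq_zero.1 hx).resolve_left (Real.rpow_pos_of_pos (norm_pos_iff.2 hx0) γ).ne'

theorem weightedNorm_eq_zero_of_ae_eq_zero {d : ℕ} (γ τ : ℝ)
    {u : EuclideanSpace ℝ (Fin d) → ℝ} (h : u =ᵐ[volume] 0) : weightedNorm γ τ u = 0 := by
  rw [weightedNorm_congr_ae γ τ h]
  simp [weightedNorm]

/-- Interpolation of a weighted norm between two weighted norms of higher integrability, one of
which controls it near the origin and the other one at infinity. -/
theorem weightedNorm_le_of_interpolation {d : ℕ} (hd : 1 ≤ d) {γ τ γ₁ τ₁ γ₂ τ₂ a e κ C₁ C₂ : ℝ}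
    (hτ : 0 < τ) (hττ₁ : τ < τ₁) (hττ₂ : τ < τ₂) (hκ : 0 < κ) (hC₁ : 0 < C₁) (hC₂ : 0 < C₂)
    (h₁ : d * (1 / τ + γ / d - (1 / τ₁ + γ₁ / d)) = κ)
    (h₂ : d * (1 / τ + γ / d - (1 / τ₂ + γ₂ / d)) = -κ) :
    ∃ K : ℝ, 0 < K ∧ ∀ u : EuclideanSpace ℝ (Fin d) → ℝ, AEMeasurable u volume →
      ∀ F W : ℝ, 0 < F → 0 < W →
      weightedNorm γ₁ τ₁ u ≤ ENNReal.ofReal (C₁ * (F ^ (a - e) * W ^ (1 - (a - e)))) →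
      weightedNorm γ₂ τ₂ u ≤ ENNReal.ofReal (C₂ * (F ^ (a + e) * W ^ (1 - (a + e)))) →
      weightedNorm γ τ u ≤ ENNReal.ofReal (K * (F ^ a * W ^ (1 - a))) := by
  have hd0 : (0 : ℝ) < d := by exact_mod_cast hd
  have hinv : ∀ τ' : ℝ, τ < τ' → 0 < 1 / τ - 1 / τ' := fun τ' h =>
    sub_pos.2 (one_div_lt_one_div_of_lt hτ h)
  have hexp : ∀ τ' γ' : ℝ, τ < τ' → (γ - γ') * (1 / (1 / τ - 1 / τ')) + d =
      d * (1 / τ + γ / d - (1 / τ' + γ' / d)) * (1 / (1 / τ - 1 / τ')) := by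
    intro τ' γ' h
    have h0 := hinv τ' h
    generalize 1 / τ = x at *
    generalize 1 / τ' = y at *
    field_simp
    ring
  have he₁ : 0 < (γ - γ₁) * (1 / (1 / τ - 1 / τ₁)) + d := by
    rw [hexp τ₁ γ₁ hττ₁, h₁]
    have := hinv τ₁ hττ₁
    positivity
  have he₂ : (γ - γ₂) * (1 / (1 / τ - 1 / τ₂)) + d < 0 := by
    rw [hexp τ₂ γ₂ hττ₂, h₂, neg_mul]
    have := hinv τ₂ hττ₂
    exact neg_neg_of_pos (by positivity)
  obtain ⟨K₁, hK₁, H₁⟩ := lintegral_norm_rpow_Ioc_le hd he₁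
  obtain ⟨K₂, hK₂, H₂⟩ := lintegral_norm_rpow_Ioi_le hd he₂
  set D₁ : ℝ := K₁ ^ (1 / (1 / (1 / τ - 1 / τ₁))) * C₁ with hD₁
  set D₂ : ℝ := K₂ ^ (1 / (1 / (1 / τ - 1 / τ₂))) * C₂ with hD₂
  have hD₁0 : 0 < D₁ := by positivity
  have hD₂0 : 0 < D₂ := by positivity
  refine ⟨(D₁ ^ τ + D₂ ^ τ) ^ (1 / τ), by positivity, ?_⟩
  intro u hu F W hF hW hN₁ hN₂
  -- The radius that balances the two regions: `R ^ κ` turns the exponents `a - e` and `a + e` both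
  -- into `a`.
  set R : ℝ := (F / W) ^ (e / κ) with hR
  have hR0 : 0 < R := by positivity
  have hRκ : R ^ κ = F ^ e * W ^ (-e) := by
    rw [hR, ← Real.rpow_mul (by positivity), div_mul_cancel₀ _ hκ.ne', Real.div_rpow hF.le hW.le,
      Real.rpow_neg hW.le, div_eq_mul_inv]
  have hRκ' : R ^ (-κ) = F ^ (-e) * W ^ e := by
    rw [Real.rpow_neg hR0.le, hRκ, mul_inv, ← Real.rpow_neg hF.le, ← Real.rpow_neg hW.le, neg_neg]
  set Y : ℝ := F ^ a * W ^ (1 - a) with hY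
  have hY0 : 0 < Y := by positivity
  have hprod : ∀ b c : ℝ, F ^ b * W ^ (-b) * (F ^ c * W ^ (1 - c)) =
      F ^ (b + c) * W ^ (1 - (b + c)) := by
    intro b c
    rw [mul_mul_mul_comm, ← Real.rpow_add hF, ← Real.rpow_add hW]
    congr 2
    ring
  have hS₁ := setLIntegral_le_weightedNorm_rpow hd hτ hττ₁ (one_div_one_div _) rfl hK₁ hR0
    (H₁ R hR0) hu
  have hS₂ := setLIntegral_le_weightedNorm_rpow hd hτ hττ₂ (one_div_one_div _) rfl hK₂ hR0
    (H₂ R hR0) hu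
  rw [h₁, hRκ] at hS₁
  rw [h₂, hRκ'] at hS₂
  have hB₁ : ∫⁻ x in (fun x : EuclideanSpace ℝ (Fin d) => ‖x‖) ⁻¹' Set.Ioc 0 R,
      ENNReal.ofReal (‖x‖ ^ (γ * τ) * |u x| ^ τ) ≤ ENNReal.ofReal (D₁ ^ τ * Y ^ τ) := by
    refine hS₁.trans ?_
    rw [← Real.mul_rpow hD₁0.le hY0.le, ← ENNReal.ofReal_rpow_of_pos (by positivity)]
    gcongr
    refine (mul_le_mul_right hN₁ _).trans_eq ?_
    rw [← ENNReal.ofReal_mul (by positivity)]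
    congr 1
    have h := hprod e (a - e)
    rw [add_sub_cancel] at h
    rw [hD₁, hY, ← h]
    ring
  have hB₂ : ∫⁻ x in (fun x : EuclideanSpace ℝ (Fin d) => ‖x‖) ⁻¹' Set.Ioi R,
      ENNReal.ofReal (‖x‖ ^ (γ * τ) * |u x| ^ τ) ≤ ENNReal.ofReal (D₂ ^ τ * Y ^ τ) := by
    refine hS₂.trans ?_
    rw [← Real.mul_rpow hD₂0.le hY0.le, ← ENNReal.ofReal_rpow_of_pos (by positivity)]
    gcongr
    refine (mul_le_mul_right hN₂ _).trans_eq ?_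
    rw [← ENNReal.ofReal_mul (by positivity)]
    congr 1
    have h := hprod (-e) (a + e)
    rw [neg_neg, show -e + (a + e) = a by ring] at h
    rw [hD₂, hY, ← h]
    ring
  have hcover : ∫⁻ x, ENNReal.ofReal (‖x‖ ^ (γ * τ) * |u x| ^ τ) ≤
      ENNReal.ofReal ((D₁ ^ τ + D₂ ^ τ) * Y ^ τ) := by
    rw [add_mul, ENNReal.ofReal_add (by positivity) (by positivity)]
    refine le_trans ?_ (add_le_add hB₁ hB₂)
    refine le_trans ?_ (lintegral_union_le _ _ _)
    rw [← Set.preimage_union, Set.Ioc_union_Ioi_eq_Ioi hR0.le]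
    have hset : (fun x : EuclideanSpace ℝ (Fin d) => ‖x‖) ⁻¹' Set.Ioi 0 =ᵐ[volume] Set.univ := by
      rw [Filter.eventuallyEq_univ]
      filter_upwards [EuclideanSpace.ae_ne_zero hd] with x hx
      exact norm_pos_iff.2 hx
    rw [setLIntegral_congr hset, setLIntegral_univ]
  rw [weightedNorm_eq γ hτ]
  calc _ ≤ ENNReal.ofReal ((D₁ ^ τ + D₂ ^ τ) * Y ^ τ) ^ (1 / τ) := by gcongr
    _ = _ := by
      rw [ENNReal.ofReal_rpow_of_pos (by positivity), Real.mul_rpow (by positivity)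
        (by positivity), ← Real.rpow_mul hY0.le, mul_one_div_cancel hτ.ne', Real.rpow_one]

/-- For `b` near `a`, the estimate with `t = 0` holds with integrability exponent `1 / ν b > τ` and
scaling number `m b`. Since `m` is affine and not constant by `hne`, `a - e` and `a + e` lie on
opposite sides in scaling, which makes the weights in Hölder's inequality integrable near the origin
and near infinity respectively. -/
theorem weightedNorm_le_of_lt {d : ℕ} (hd : 1 ≤ d) {s p q τ a α β γ Λ l : ℝ}
    (hs : 0 < s) (hp : 0 < p) (hq : 0 < q) (hτ : 0 < τ) (ha0 : 0 < a) (ha1 : a < 1)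
    (hl : 1 < l) (hlΛ : l * l = Λ) (hτlt : a / p + (1 - a) / q < 1 / τ)
    (hbalance : 1 / τ + γ / d = a * (1 / p + (α - s) / d) + (1 - a) * (1 / q + β / d))
    (hne : 1 / p + (α - s) / d ≠ 1 / q + β / d) {j : ℤ} (hj : j = 1 ∨ j = -1)
    (hsign : 0 < j * (1 / τ + γ / d)) :
    ∃ C : ℝ≥0, 0 < C ∧ ∀ u : EuclideanSpace ℝ (Fin d) → ℝ, AEMeasurable u volume →
      VanishesAlongRay l j u →
      weightedNorm γ τ u ≤
        C * fracSeminorm s p α Λ Set.univ u ^ a * weightedNorm β q u ^ (1 - a) := by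
  have hd0 : (0 : ℝ) < d := by exact_mod_cast hd
  set m : ℝ → ℝ := fun b => b * (1 / p + (α - s) / d) + (1 - b) * (1 / q + β / d) with hm
  set ν : ℝ → ℝ := fun b => b / p + (1 - b) / q with hν
  have hnhds : ∀ᶠ b in 𝓝 a, 0 < b ∧ b < 1 ∧ ν b < 1 / τ ∧ 0 < j * m b := by
    have hmc : Continuous m := by fun_prop
    have hνc : Continuous ν := by fun_prop
    refine (lt_mem_nhds ha0).and ((gt_mem_nhds ha1).and (Filter.Eventually.and ?_ ?_))
    · exact hνc.continuousAt.eventually (gt_mem_nhds hτlt)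
    · have hjm : Continuous fun b => j * m b := by fun_prop
      refine hjm.continuousAt.eventually (lt_mem_nhds ?_)
      simp only [hm]
      rwa [← hbalance]
  obtain ⟨ε, hε, hball⟩ := Metric.eventually_nhds_iff.1 hnhds
  -- The sign of `e` is chosen so that `a - e` gives the smaller scaling number and serves near the
  -- origin.
  obtain ⟨e, heε, he⟩ : ∃ e : ℝ, |e| < ε ∧
      0 < e * (1 / p + (α - s) / d - (1 / q + β / d)) := by
    rcases lt_or_gt_of_ne hne with h | h
    · exact ⟨-(ε / 2), by rw [abs_neg, abs_of_pos (by positivity)]; linarith,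
        mul_pos_of_neg_of_neg (by linarith) (by linarith)⟩
    · exact ⟨ε / 2, by rw [abs_of_pos (by positivity)]; linarith,
        mul_pos (by linarith) (by linarith)⟩
  have hend : ∀ b, 0 < b → b < 1 → ν b < 1 / τ → 0 < j * m b →
      τ < 1 / ν b ∧
      1 / (1 / ν b) + (b * (α - s) + (1 - b) * β) / d = m b ∧
      ∃ C : ℝ≥0, 0 < C ∧ ∀ u : EuclideanSpace ℝ (Fin d) → ℝ, AEMeasurable u volume →
        VanishesAlongRay l j u →
        weightedNorm (b * (α - s) + (1 - b) * β) (1 / ν b) u ≤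
          C * fracSeminorm s p α Λ Set.univ u ^ b * weightedNorm β q u ^ (1 - b) := by
    intro b hb0 hb1 hbν hbm
    have h1b : 0 < 1 - b := by linarith
    have hν0 : 0 < ν b := by simp only [hν]; positivity
    have hbal : 1 / (1 / ν b) + (b * (α - s) + (1 - b) * β) / d = m b := by
      rw [one_div_one_div]; simp only [hν, hm]; ring
    refine ⟨by rwa [lt_one_div hτ hν0], hbal, ?_⟩
    refine weightedNorm_le_of_vanishesAlongRay hd (t := 0) hs hp hq (by positivity) hb0 hb1.le
      le_rfl hs.le hl hlΛ ?_ ?_ hj ?_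
    · rw [one_div_one_div]; simp [hν]
    · ring
    · have h : (b * (α - s) + (1 - b) * β) * (1 / ν b) + d = m b * (d * (1 / ν b)) := by
        rw [← hbal]; field_simp; ring
      rw [h, ← mul_assoc]
      positivity
  have hdist : ∀ x : ℝ, |x| < ε → dist (a + x) a < ε := fun x hx => by
    rwa [Real.dist_eq, add_sub_cancel_left]
  obtain ⟨h10, h11, h1ν, h1m⟩ := hball (hdist (-e) (by rwa [abs_neg]))
  obtain ⟨h20, h21, h2ν, h2m⟩ := hball (hdist e heε)
  rw [← sub_eq_add_neg] at h10 h11 h1ν h1m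
  obtain ⟨hτ₁, hbal₁, C₁, hC₁, H₁⟩ := hend (a - e) h10 h11 h1ν h1m
  obtain ⟨hτ₂, hbal₂, C₂, hC₂, H₂⟩ := hend (a + e) h20 h21 h2ν h2m
  obtain ⟨K, hK, H⟩ := weightedNorm_le_of_interpolation (a := a) (e := e) (C₁ := C₁) (C₂ := C₂)
    (κ := d * (e * (1 / p + (α - s) / d - (1 / q + β / d)))) hd (γ := γ) hτ hτ₁ hτ₂
    (by positivity) hC₁ hC₂ (by rw [hbal₁, hbalance]; simp only [hm]; ring)
    (by rw [hbal₂, hbalance]; simp only [hm]; ring)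
  refine ⟨K.toNNReal, by simpa using hK, ?_⟩
  intro u hu hsupp
  set F := fracSeminorm s p α Λ Set.univ u with hF
  set W := weightedNorm β q u with hW
  have h1a : 0 < 1 - a := by linarith
  have hKne : (K.toNNReal : ℝ≥0∞) ≠ 0 := by simpa using hK
  -- With `F = 0` the right side of the estimate at `a - e` vanishes even if `W` is infinite, so `u`
  -- is zero almost everywhere.
  rcases eq_or_ne F 0 with hF0 | hF0
  · have h := H₁ u hu hsupp
    rw [← hF, hF0, ENNReal.zero_rpow_of_pos h10, mul_zero, zero_mul, nonpos_iff_eq_zero] at h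
    rw [weightedNorm_eq_zero_of_ae_eq_zero γ τ
      (ae_eq_zero_of_weightedNorm_eq_zero hd (hτ.trans hτ₁) hu h)]
    exact zero_le
  rcases eq_or_ne W 0 with hW0 | hW0
  · rw [weightedNorm_eq_zero_of_ae_eq_zero γ τ (ae_eq_zero_of_weightedNorm_eq_zero hd hq hu hW0)]
    exact zero_le
  rcases eq_or_ne F ∞ with hFt | hFt
  · rw [hFt, ENNReal.top_rpow_of_pos ha0, ENNReal.mul_top hKne, ENNReal.top_mul]
    · exact le_top
    · rwa [Ne, ENNReal.rpow_eq_zero_iff_of_pos h1a]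
  rcases eq_or_ne W ∞ with hWt | hWt
  · rw [hWt, ENNReal.top_rpow_of_pos h1a, ENNReal.mul_top]
    · exact le_top
    · refine mul_ne_zero hKne ?_
      rwa [Ne, ENNReal.rpow_eq_zero_iff_of_pos ha0]
  have hFr := ENNReal.toReal_pos hF0 hFt
  have hWr := ENNReal.toReal_pos hW0 hWt
  have hconv : ∀ (D : ℝ≥0) (b : ℝ), D * F ^ b * W ^ (1 - b) =
      ENNReal.ofReal (D * (F.toReal ^ b * W.toReal ^ (1 - b))) := by
    intro D b
    rw [ENNReal.ofReal_mul D.coe_nonneg, ENNReal.ofReal_mul (by positivity),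
      ← ENNReal.ofReal_rpow_of_pos hFr, ← ENNReal.ofReal_rpow_of_pos hWr,
      ENNReal.ofReal_toReal hFt, ENNReal.ofReal_toReal hWt, ENNReal.ofReal_coe_nnreal, mul_assoc]
  have h := H u hu F.toReal W.toReal hFr hWr ((H₁ u hu hsupp).trans_eq (hconv _ _))
    ((H₂ u hu hsupp).trans_eq (hconv _ _))
  rwa [hconv, Real.coe_toNNReal K hK.le]

/-! ### Assembly of the cases. -/

theorem weightedNorm_le_fracSeminorm {d : ℕ} (hd : 1 ≤ d) {s p q τ a α β γ σ Λ l : ℝ}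
    (hs : 0 < s) (hp : 0 < p) (hq : 0 < q) (hτ : 0 < τ) (ha0 : 0 < a) (ha1 : a ≤ 1)
    (hl : 1 < l) (hlΛ : l * l = Λ) (hσ : γ = a * σ + (1 - a) * β)
    (hbalance : 1 / τ + γ / d = a * (1 / p + (α - s) / d) + (1 - a) * (1 / q + β / d))
    (hασ : 0 ≤ α - σ) (hborder : 1 / τ + γ / d = 1 / p + (α - s) / d → α - σ ≤ s)
    {j : ℤ} (hj : j = 1 ∨ j = -1) (hsign : 0 < j * (1 / τ + γ / d)) :
    ∃ C : ℝ≥0, 0 < C ∧ ∀ u : EuclideanSpace ℝ (Fin d) → ℝ, AEMeasurable u volume →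
      VanishesAlongRay l j u →
      weightedNorm γ τ u ≤
        C * fracSeminorm s p α Λ Set.univ u ^ a * weightedNorm β q u ^ (1 - a) := by
  have hd0 : (0 : ℝ) < d := by exact_mod_cast hd
  have hτeq : 1 / τ = a / p + (1 - a) / q - a * (s - (α - σ)) / d := by
    have h : 1 / τ = a * (1 / p + (α - s) / d) + (1 - a) * (1 / q + β / d) - γ / d := by linarith
    rw [h, hσ]; ring
  rcases le_or_gt (α - σ) s with hle | hgt
  · refine weightedNorm_le_of_vanishesAlongRay hd (t := s - (α - σ)) hs hp hq hτ ha0 ha1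
      (by linarith) (by linarith) hl hlΛ hτeq (by rw [hσ]; ring) hj ?_
    have h : γ * τ + d = (1 / τ + γ / d) * (d * τ) := by field_simp; ring
    rw [h, ← mul_assoc]
    positivity
  · have hnb : 1 / τ + γ / d ≠ 1 / p + (α - s) / d := fun h => absurd (hborder h) (not_le.2 hgt)
    have ha1' : a < 1 := by
      refine lt_of_le_of_ne ha1 ?_
      rintro rfl
      exact hnb (by linarith)
    refine weightedNorm_le_of_lt hd hs hp hq hτ ha0 ha1' hl hlΛ ?_ hbalance ?_ hj hsign
    · rw [hτeq]
      have : 0 < a * ((α - σ) - s) / d := div_pos (mul_pos ha0 (by linarith)) hd0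
      have h2 : a * (s - (α - σ)) / d = -(a * ((α - σ) - s) / d) := by ring
      linarith
    · intro h
      refine hnb ?_
      rw [hbalance, ← h]; ring

theorem mainTheorem3 (d : ℕ) (hd : 1 ≤ d) (s p q τ a α β γ σ Λ : ℝ)
    (hs0 : 0 < s) (hs1 : s < 1) (hp : 1 < p) (hq : 1 ≤ q) (hτ : 1 ≤ τ)
    (ha0 : 0 < a) (ha1 : a ≤ 1) (hΛ : 1 < Λ)
    (hσ : γ = a * σ + (1 - a) * β)
    (hbalance : 1 / τ + γ / d = a * (1 / p + (α - s) / d) + (1 - a) * (1 / q + β / d))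
    (hασ : 0 ≤ α - σ)
    (hborder : 1 / τ + γ / d = 1 / p + (α - s) / d → α - σ ≤ s) :
    ∃ C : ℝ≥0, 0 < C ∧
      (0 < 1 / τ + γ / d →
        ∀ u : EuclideanSpace ℝ (Fin d) → ℝ, LocallyIntegrableOn u {0}ᶜ volume →
          HasEssCompactSupport u →
          weightedNorm γ τ u ≤
            C * fracSeminorm s p α Λ Set.univ u ^ a * weightedNorm β q u ^ (1 - a)) ∧
      (1 / τ + γ / d < 0 →
        ∀ u : EuclideanSpace ℝ (Fin d) → ℝ, LocallyIntegrableOn u {0}ᶜ volume →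
          VanishesNearZero u →
          weightedNorm γ τ u ≤
            C * fracSeminorm s p α Λ Set.univ u ^ a * weightedNorm β q u ^ (1 - a)) := by
  have hmeas : ∀ u : EuclideanSpace ℝ (Fin d) → ℝ, LocallyIntegrableOn u {0}ᶜ volume →
      AEMeasurable u volume := by
    intro u hu
    have : Nonempty (Fin d) := ⟨⟨0, hd⟩⟩
    have h := hu.aestronglyMeasurable.aemeasurable
    rwa [restrict_compl_singleton] at h
  have hl : 1 < √Λ := by rw [Real.lt_sqrt one_pos.le]; simpa using hΛ
  have hlΛ : √Λ * √Λ = Λ := Real.mul_self_sqrt (by linarith)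
  have key : ∀ j : ℤ, j = 1 ∨ j = -1 → 0 < j * (1 / τ + γ / d) → _ := fun j hj hsign =>
    weightedNorm_le_fracSeminorm (j := j) hd hs0 (by linarith) (by linarith) (by linarith) ha0 ha1
      hl hlΛ hσ hbalance hασ hborder hj hsign
  rcases lt_trichotomy (1 / τ + γ / d) 0 with hneg | hzero | hpos
  · obtain ⟨C, hC, H⟩ := key (-1) (Or.inr rfl) (by push_cast; linarith)
    exact ⟨C, hC, fun h => absurd h hneg.not_gt,
      fun _ u hu hsupp => H u (hmeas u hu) (hsupp.vanishesAlongRay hl)⟩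
  -- At the critical value both cases are vacuous, so any constant serves.
  · exact ⟨1, one_pos, fun h => absurd hzero h.ne', fun h => absurd hzero h.ne⟩
  · obtain ⟨C, hC, H⟩ := key 1 (Or.inl rfl) (by push_cast; linarith)
    exact ⟨C, hC, fun _ u hu hsupp => H u (hmeas u hu) (hsupp.vanishesAlongRay hl),
      fun h => absurd h hpos.not_gt⟩
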